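/- Let $\mathbb K$ be an algebraically closed field of characteristic zero, let $\omega\in\mathbb R^N$ have rationally independent coordinates, and write $\mathbb K[x^*,y]=\mathbb K[x_1^{\pm1},\dots,x_N^{\pm1},y_1,\dots,y_M]$. An ideal $\mathcal I\subset\mathbb K[x^*,y]$ is \emph{$N$-admissible} if the projection $(x,y)\mapsto x$ from the set of common zeroes of $\mathcal I\cap\mathbb K[x,y]$ in $\mathbb K^{N+M}$ to $\mathbb K^N$ is dominant with finite generic fibre. For $\eta\in(\mathbb R\cup\{\infty\})^M$ (with $\infty\cdot 0=0$ and $\infty\cdot a=\infty$ for $a\ne0$) put $\Lambda(\eta)=\{i\mid\eta_i\neq\infty\}$. The $(\omega,\eta)$-order of $f=\sum a_{\alpha,\beta}x^\alpha y^\beta$ is $\min_{a_{\alpha,\beta}\ne0}(\omega\cdot\alpha+\eta\cdot\beta)$; its initial part $\mathrm{In}_{\omega,\eta}f$ is the sum of the terms attaining a finite minimum, and $0$ if the order is $\infty$; $\mathrm{In}_{\omega,\eta}\mathcal I$ is the ideal generated by all $\mathrm{In}_{\omega,\eta}f$, $f\in\mathcal I$, and all $y_i$, $i\notin\Lambda(\eta)$.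 The tropical variety $\tau(\mathcal I)$ is the set of $(\omega,\eta)$ such that $\mathrm{In}_{\omega,\eta}\mathcal I$ contains no monomial $a x^\alpha y^\beta$, $a\neq0$, involving only the $y_i$ with $i\in\Lambda(\eta)$. An \emph{$\omega$-set} is a triple $D=\{\eta,\Gamma,c\}$ with $\eta\in(\mathbb R\cup\{\infty\})^M$, $\Gamma$ an $M\times N$ matrix over $\mathbb Q\cup\{\infty\}$ and $c\in\mathbb K^M$, such that $\omega\cdot\Gamma_{i,*}=\eta_i$ and $c_i\ne0$ for $i\in\Lambda(\eta)$, while all entries of $\Gamma_{i,*}$ are $\infty$ and $c_i=0$ for $i\notin\Lambda(\eta)$. It is a \emph{starting $\omega$-set} for $\mathcal I$ if $(\omega,\eta)\in\tau(\mathcal I)$ and $f(\underline 1,c)=0$ for all $f\in\mathrm{In}_{\omega,\eta}\mathcal I$. Let $\mathbf d\Gamma$ be the least common multiple of the denominators of the finite entries of $\Gamma$, and let $\mathcal I_D\subset\mathbb K[x^*,y]$ be the ideal generated by the polynomials obtained from the elements of $\mathcal I$ by substituting $x_j\mapsto x_j^{\mathbf d\Gamma}$ and $y_i\mapsto y_i+c_ix^{\mathbf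 d\Gamma\,\Gamma_{i,*}}$ (where $c_ix^{\mathbf d\Gamma\,\Gamma_{i,*}}:=0$ if $i\notin\Lambda(\eta)$). For $k\in\mathbb Z_{\ge0}\cup\{\infty\}$, a sequence $\{D^{(i)}\}_{i=0}^{k}$ of $\omega$-sets $D^{(i)}=\{\eta^{(i)},\Gamma^{(i)},c^{(i)}\}$ is an \emph{$\omega$-sequence} for $\mathcal I$ if, with $\mathcal I^{(0)}=\mathcal I$ and $\mathcal I^{(i)}=\mathcal I^{(i-1)}_{D^{(i-1)}}$, each $D^{(i)}$ is a starting $\omega$-set for $\mathcal I^{(i)}$ and, for all $i\ge1$, $\eta^{(i)}_j>\mathbf d\Gamma^{(i-1)}\eta^{(i-1)}_j$ for every $j\in\Lambda(\eta^{(i)})$. Let $\mathcal I\subset\mathbb K[x^*,y]$ be an $N$-admissible ideal. (1) For every starting $\omega$-set $D=\{\eta,\Gamma,c\}$ for $\mathcal I$, the ideal $\mathcal I_D$ is $N$-admissible and there is a starting $\omega$-set $D'=\{\eta',\Gamma',c'\}$ for $\mathcal I_D$ with $\eta'_j>\mathbf d\Gamma\,\eta_j$ for every $j\in\Lambda(\eta')$.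 (2) For every finite $\omega$-sequence $\{D^{(i)}\}_{i=0}^{k}$ for $\mathcal I$ and every $k'\in\{k+1,k+2,\dots\}\cup\{\infty\}$ there are $D^{(i)}$, $k<i\le k'$, such that $\{D^{(i)}\}_{i=0}^{k'}$ is an $\omega$-sequence for $\mathcal I$. In particular, every finite $\omega$-sequence for $\mathcal I$ extends to an infinite one. -/

import Mathlib

namespace NewtonPuiseux

noncomputable section

/-- The Laurent polynomial ring `K[x*] = K[x₁, x₁⁻¹, …, x_N, x_N⁻¹]`:
`AddMonoidAlgebra.single α a` is the term `a x^α`, `α ∈ ℤ^N`. -/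
abbrev Laurent (K : Type*) [Field K] (N : ℕ) : Type _ :=
  AddMonoidAlgebra K (Fin N → ℤ)

/-- The ring `K[x*, y] = K[x*][y₁, …, y_M]`. -/
abbrev LaurentPoly (K : Type*) [Field K] (N M : ℕ) : Type _ :=
  MvPolynomial (Fin M) (Laurent K N)

section Admissible

variable {K : Type*} [Field K] {N M : ℕ}

/-- The inclusion of `K[x, y]` in `K[x*, y]`; the variables `Sum.inl j` are the `x_j` and the
variables `Sum.inr i` are the `y_i`. -/
def inclusion (K : Type*) [Field K] (N M : ℕ) :
    MvPolynomial (Fin N ⊕ Fin M) K →+* LaurentPoly K N M :=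
  MvPolynomial.eval₂Hom (MvPolynomial.C.comp (algebraMap K (Laurent K N)))
    (Sum.elim (fun j => MvPolynomial.C (AddMonoidAlgebra.single (Pi.single j 1) 1))
      MvPolynomial.X)

/-- The set of common zeroes in `K^(N+M)` of an ideal of `K[x, y]`, as a set of pairs `(x, y)`. -/
def commonZeroes (J : Ideal (MvPolynomial (Fin N ⊕ Fin M) K)) :
    Set ((Fin N → K) × (Fin M → K)) :=
  {p | ∀ f ∈ J, MvPolynomial.eval (Sum.elim p.1 p.2) f = 0}

/-- An ideal of `K[x, y]` is `N`-admissible when the projection of its set of common zeroes to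
`K^N` is dominant (the image is Zariski dense) and of finite generic fibre (the fibres over a
nonempty Zariski open subset of `K^N` are finite). -/
def IsNAdmissiblePoly (J : Ideal (MvPolynomial (Fin N ⊕ Fin M) K)) : Prop :=
  (∀ p : MvPolynomial (Fin N) K,
      (∀ x ∈ Prod.fst '' commonZeroes J, MvPolynomial.eval x p = 0) → p = 0) ∧
  (∃ q : MvPolynomial (Fin N) K, q ≠ 0 ∧
      ∀ x : Fin N → K, MvPolynomial.eval x q ≠ 0 → {y | (x, y) ∈ commonZeroes J}.Finite)

/-- An ideal of `K[x*, y]` is `N`-admissible when its contraction to `K[x, y]` is. -/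
def IsNAdmissible (I : Ideal (LaurentPoly K N M)) : Prop :=
  IsNAdmissiblePoly (I.comap (inclusion K N M))

end Admissible

section Initial

variable {K : Type*} [Field K] {N M : ℕ}

/-- The weight `ω · α + η · β` of the monomial `x^α y^β`. In `WithTop ℝ` one has `0 * ⊤ = 0` and
`a * ⊤ = ⊤` for every `a ≠ 0`. -/
def weight (ω : Fin N → ℝ) (η : Fin M → WithTop ℝ) (α : Fin N → ℤ) (β : Fin M →₀ ℕ) :
    WithTop ℝ :=
  ((∑ j, ω j * (α j : ℝ) : ℝ) : WithTop ℝ) + ∑ i, ((β i : ℝ) : WithTop ℝ) * η i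

/-- The `(ω, η)`-order: the least weight of a term of `f` (`∞` if `f = 0`). -/
def polyOrder (ω : Fin N → ℝ) (η : Fin M → WithTop ℝ) (f : LaurentPoly K N M) : WithTop ℝ :=
  f.support.inf fun β => (f.coeff β).coeff.support.inf fun α => weight ω η α β

open Classical in
/-- The `(ω, η)`-initial part: the sum of the terms of least weight, and `0` if the
`(ω, η)`-order is `∞`. -/
def initialPart (ω : Fin N → ℝ) (η : Fin M → WithTop ℝ) (f : LaurentPoly K N M) :
    LaurentPoly K N M :=
  if polyOrder ω η f = ⊤ then 0
  else ∑ β ∈ f.support, ∑ α ∈ (f.coeff β).coeff.support with weight ω η α β = polyOrder ω η f,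
    MvPolynomial.monomial β (AddMonoidAlgebra.single α ((f.coeff β).coeff α))

/-- The `(ω, η)`-initial ideal: generated by the initial parts of the elements of `I` and by the
variables `y_i` with `η_i = ∞`. -/
def initialIdeal (ω : Fin N → ℝ) (η : Fin M → WithTop ℝ) (I : Ideal (LaurentPoly K N M)) :
    Ideal (LaurentPoly K N M) :=
  Ideal.span (initialPart ω η '' (I : Set (LaurentPoly K N M)) ∪
    MvPolynomial.X '' {i : Fin M | η i = ⊤})

/-- The tropical variety of `I`: the `(ω, η)` for which the initial ideal contains no monomial
`a x^α y^β`, `a ≠ 0`, in the variables `x` and the `y_i` with `η_i ≠ ∞`. -/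
def tropicalVariety (I : Ideal (LaurentPoly K N M)) :
    Set ((Fin N → ℝ) × (Fin M → WithTop ℝ)) :=
  {p | ∀ (a : K) (α : Fin N → ℤ) (β : Fin M →₀ ℕ), a ≠ 0 → (∀ i, p.2 i = ⊤ → β i = 0) →
    MvPolynomial.monomial β (AddMonoidAlgebra.single α a) ∉ initialIdeal p.1 p.2 I}

/-- The value `f(1, c)` of `f ∈ K[x*, y]` at `x = (1, …, 1)`, `y = c`. -/
def evalOne (c : Fin M → K) : LaurentPoly K N M →+* K :=
  MvPolynomial.eval₂Hom
    (AddMonoidAlgebra.lift K K (Fin N → ℤ) (1 : Multiplicative (Fin N → ℤ) →* K)).toRingHom c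

end Initial

/-- An `ω`-set `{η, Γ, c}`. The equation `ω · Γᵀ = η` is required in the rows with `η_i ≠ ∞`; in
the other rows it is a consequence of `Γ_{i,*} = ∞` when `N ≥ 1` and all `ω_j` are nonzero. -/
structure OmegaSet (K : Type*) [Field K] {N : ℕ} (M : ℕ) (ω : Fin N → ℝ) where
  η : Fin M → WithTop ℝ
  Γ : Matrix (Fin M) (Fin N) (WithTop ℚ)
  c : Fin M → K
  dot_eq : ∀ i, η i ≠ ⊤ →
    ∑ j, (ω j : WithTop ℝ) * (Γ i j).map (fun q : ℚ => (q : ℝ)) = η i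
  row_eq_top : ∀ i, η i = ⊤ → ∀ j, Γ i j = ⊤
  c_ne_zero : ∀ i, η i ≠ ⊤ → c i ≠ 0
  c_eq_zero : ∀ i, η i = ⊤ → c i = 0

/-- `dΓ`: the least common multiple of the denominators of the finite entries of `Γ`. -/
def denom {N M : ℕ} (Γ : Matrix (Fin M) (Fin N) (WithTop ℚ)) : ℕ :=
  Finset.univ.lcm fun p : Fin M × Fin N => ((Γ p.1 p.2).untopD 0).den

/-- The row `dΓ · Γ_{i,*}`, which is integral; the entries equal to `∞` are replaced by `0`. -/
def scaledRow {N M : ℕ} (Γ : Matrix (Fin M) (Fin N) (WithTop ℚ)) (i : Fin M) : Fin N → ℤ :=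
  fun j => ((denom Γ : ℚ) * (Γ i j).untopD 0).num

theorem denom_pos {N M : ℕ} (Γ : Matrix (Fin M) (Fin N) (WithTop ℚ)) : 0 < denom Γ := by
  refine Nat.pos_of_ne_zero fun h => ?_
  obtain ⟨p, -, hp⟩ := Finset.lcm_eq_zero_iff.1 h
  exact Rat.den_nz _ hp

theorem scaledRow_cast {N M : ℕ} (Γ : Matrix (Fin M) (Fin N) (WithTop ℚ)) (i : Fin M)
    (j : Fin N) : (scaledRow Γ i j : ℚ) = (denom Γ : ℚ) * (Γ i j).untopD 0 := by
  obtain ⟨k, hk⟩ : ((Γ i j).untopD 0).den ∣ denom Γ :=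
    Finset.dvd_lcm (f := fun p : Fin M × Fin N => ((Γ p.1 p.2).untopD 0).den)
      (Finset.mem_univ (i, j))
  have h : (denom Γ : ℚ) * (Γ i j).untopD 0 = ((k * ((Γ i j).untopD 0).num : ℤ) : ℚ) := by
    rw [hk]
    push_cast
    rw [mul_comm (((Γ i j).untopD 0).den : ℚ), mul_assoc, mul_comm _ ((Γ i j).untopD 0),
      Rat.mul_den_eq_num]
  rw [scaledRow, h, Rat.num_intCast]

/-- `dΓ` is the least positive integer `k` such that `k Γ` has all its entries in `ℤ ∪ {∞}`. -/
theorem denom_le {N M : ℕ} (Γ : Matrix (Fin M) (Fin N) (WithTop ℚ)) (k : ℕ) (hk : 0 < k)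
    (h : ∀ i j, ∃ z : ℤ, (k : ℚ) * (Γ i j).untopD 0 = z) : denom Γ ≤ k := by
  refine Nat.le_of_dvd hk (Finset.lcm_dvd fun p _ => ?_)
  obtain ⟨z, hz⟩ := h p.1 p.2
  have hk' : (k : ℚ) ≠ 0 := by exact_mod_cast hk.ne'
  have : (Γ p.1 p.2).untopD 0 = Rat.divInt z k := by
    rw [Rat.divInt_eq_div, eq_div_iff (by exact_mod_cast hk.ne'), mul_comm]
    exact_mod_cast hz
  rw [this]
  exact_mod_cast Rat.den_dvd z k

section Sequences

variable {K : Type*} [Field K] {N M : ℕ} {ω : Fin N → ℝ}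

/-- `D` is a starting `ω`-set for `I`. -/
def IsStarting (I : Ideal (LaurentPoly K N M)) (D : OmegaSet K M ω) : Prop :=
  (ω, D.η) ∈ tropicalVariety I ∧ ∀ f ∈ initialIdeal ω D.η I, evalOne D.c f = 0

/-- The substitution `f(x, y) ↦ f(x^{dΓ}, y + 𝔐_D(x^{dΓ}))`, where `𝔐_D(x^{dΓ})` has the entries
`c_i x^{dΓ Γ_{i,*}}` (so `0` where `η_i = ∞`). -/
def substitution (D : OmegaSet K M ω) : LaurentPoly K N M →+* LaurentPoly K N M :=
  MvPolynomial.eval₂Hom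
    (MvPolynomial.C.comp (AddMonoidAlgebra.mapDomainRingHom K
      (nsmulAddMonoidHom (α := Fin N → ℤ) (denom D.Γ))))
    (fun i => MvPolynomial.X i +
      MvPolynomial.C (AddMonoidAlgebra.single (scaledRow D.Γ i) (D.c i)))

/-- The transformed ideal `I_D`, generated by the `f(x^{dΓ}, y + 𝔐_D(x^{dΓ}))`, `f ∈ I`. -/
def transform (I : Ideal (LaurentPoly K N M)) (D : OmegaSet K M ω) :
    Ideal (LaurentPoly K N M) :=
  Ideal.span (substitution D '' (I : Set (LaurentPoly K N M)))

/-- `η'_i > dΓ · η_i` for every `i` with `η'_i ≠ ∞`. -/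
def Exceeds (D D' : OmegaSet K M ω) : Prop :=
  ∀ i, D'.η i ≠ ⊤ → ((denom D.Γ : ℝ) : WithTop ℝ) * D.η i < D'.η i

/-- The ideals `I⁽⁰⁾ = I`, `I⁽ⁱ⁺¹⁾ = (I⁽ⁱ⁾)_{D⁽ⁱ⁾}`. -/
def idealSeq (I : Ideal (LaurentPoly K N M)) (S : ℕ → OmegaSet K M ω) :
    ℕ → Ideal (LaurentPoly K N M)
  | 0 => I
  | i + 1 => transform (idealSeq I S i) (S i)

/-- The terms `S 0, …, S L` (all the terms if `L = ∞`) form an `ω`-sequence for `I`. The terms of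
`S` beyond the index `L` play no role. -/
def IsOmegaSequence (I : Ideal (LaurentPoly K N M)) (L : ℕ∞) (S : ℕ → OmegaSet K M ω) : Prop :=
  (∀ i : ℕ, (i : ℕ∞) ≤ L → IsStarting (idealSeq I S i) (S i)) ∧
  (∀ i : ℕ, ((i + 1 : ℕ) : ℕ∞) ≤ L → Exceeds (S i) (S (i + 1)))

end Sequences

end

end NewtonPuiseux

/-!
By Chevalley's theorem and the Nullstellensatz, `I` is `N`-admissible exactly when `I ∩ K[x*] = 0`
and every `y_i` is algebraic over `K[x*]` modulo `I`. The substitution defining `I_D` preserves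
algebraicity; what has to be shown is that a starting `ω`-set consists of the leading terms
`c_i x^{Γ_{i,*}}` of a point of `I`.

Let `d = dΓ`, replace `x` by `x^d`, and consider the polynomials in `x` and `t_i = x^{-r_i} y_i`,
`r_i = d Γ_{i,*}`, whose coefficients have nonnegative `ω`-order. They have a residue, given by
`x ↦ 0`, `t_i ↦ c_i`. When `D` is a starting `ω`-set, the ideal generated by the `f(x^d, y)`,
`f ∈ I`, and the `y_i` with `η_i = ∞` contains no polynomial of nonzero residue, since each of its
elements splits along the classes of the exponents modulo `d` into pieces of the form
`x^κ f(x^d, y)`. A prime ideal above it that still avoids the polynomials of nonzero residue gives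
a point `y` of `I` over an algebraically closed field `L` containing `K[x*]`, and a valuation ring
of `L` dominating the residue map makes the `c_i x^{r_i}` the leading terms of the `y_i`.

Then `z_i = y_i - c_i x^{r_i}` is a point of `I_D`, so `I_D ∩ K[x*] = 0`. As `z_i` is algebraic over
`K[x*]`, its value is commensurable with that of a monomial in `x` and its leading coefficient lies
in `K`. Hence `z` has leading terms, those of an `ω`-set `D'`, which is a starting `ω`-set for `I_D`
and exceeds `D` because `v(z_i) < v(x^{r_i})`.
-/

namespace NewtonPuiseux

noncomputable section

open MvPolynomial
open AddMonoidAlgebra (single mapDomainRingHom)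

section MonoidAlgebra

variable {R A G : Type*} [CommSemiring R] [AddCommMonoid A] [AddCommGroup G]

theorem single_neg_mul_single (γ : G) : single (-γ) (1 : R) * single γ 1 = 1 := by
  rw [AddMonoidAlgebra.single_mul_single, neg_add_cancel, one_mul, AddMonoidAlgebra.one_def]

theorem single_mul_single_neg (γ : G) : single γ (1 : R) * single (-γ) 1 = 1 := by
  rw [mul_comm, single_neg_mul_single]

theorem exists_map_mapDomainRingHom_eq (ι : A →+ G) (γ : G)
    (p : Polynomial (AddMonoidAlgebra R G))
    (hp : ∀ n, ∀ α ∈ (p.coeff n).coeff.support, γ + α ∈ Set.range ι) :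
    ∃ q : Polynomial (AddMonoidAlgebra R A),
      q.map (mapDomainRingHom R ι) = Polynomial.C (single γ 1) * p := by
  rw [← Polynomial.mem_lifts, Polynomial.lifts_iff_coeff_lifts]
  intro n
  rw [Polynomial.coeff_C_mul, ← RingHom.coe_rangeS, SetLike.mem_coe,
    ← AddMonoidAlgebra.sum_coeff_single (p.coeff n), Finsupp.sum, Finset.mul_sum]
  refine sum_mem fun α hα => ?_
  obtain ⟨a, ha⟩ := hp n α hα
  exact ⟨single a ((p.coeff n).coeff α), by
    rw [AddMonoidAlgebra.mapDomainRingHom_apply, AddMonoidAlgebra.mapDomain_single, ha,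
      AddMonoidAlgebra.single_mul_single, one_mul]⟩

/-- The finite set of all exponents of the coefficients of `p`: a lower bound of it is the monomial
that clears denominators. -/
def exponents (p : Polynomial (AddMonoidAlgebra R G)) : Finset G :=
  open Classical in p.support.biUnion fun n => (p.coeff n).coeff.support

theorem mem_exponents {p : Polynomial (AddMonoidAlgebra R G)} {α : G} :
    α ∈ exponents p ↔ ∃ n, (p.coeff n).coeff α ≠ 0 := by
  simp only [exponents, Finset.mem_biUnion, Polynomial.mem_support_iff, Finsupp.mem_support_iff]
  exact exists_congr fun n => and_iff_right_of_imp fun h h0 => h (by rw [h0]; rfl)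

theorem exponents_nonempty {p : Polynomial (AddMonoidAlgebra R G)} (hp : p ≠ 0) :
    (exponents p).Nonempty := by
  by_contra! h
  refine hp (Polynomial.ext fun n => AddMonoidAlgebra.ext (Finsupp.ext fun α => ?_))
  by_contra h0
  exact Finset.eq_empty_iff_forall_notMem.1 h α (mem_exponents.2 ⟨n, h0⟩)

end MonoidAlgebra

section Admissibility

theorem exists_isPrime_injective_quotientMk_comp {A B : Type*} [CommRing A] [IsDomain A]
    [CommRing B] (f : A →+* B) {J : Ideal B} (hJ : ∀ a, f a ∈ J → a = 0) :
    ∃ P : Ideal B, P.IsPrime ∧ J ≤ P ∧ Function.Injective ((Ideal.Quotient.mk P).comp f) := by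
  have hdisj : Disjoint (J : Set B) ((nonZeroDivisors A).map f) := by
    rw [Set.disjoint_left]
    rintro _ hb ⟨a, ha, rfl⟩
    exact nonZeroDivisors.ne_zero ha (hJ a hb)
  obtain ⟨P, hP, hJP, hPd⟩ := Ideal.exists_le_prime_disjoint _ _ hdisj
  refine ⟨P, hP, hJP, (injective_iff_map_eq_zero _).2 fun a ha => ?_⟩
  by_contra ha0
  exact Set.disjoint_left.1 hPd (Ideal.Quotient.eq_zero_iff_mem.1 ha)
    ⟨a, mem_nonZeroDivisors_of_ne_zero ha0, rfl⟩

theorem exists_ne_zero_forall_mem_range_comap {A B : Type*} [CommRing A] [IsDomain A]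
    [CommRing B] [IsDomain B] {f : A →+* B} (hf : f.FinitePresentation)
    (hinj : Function.Injective f) :
    ∃ a : A, a ≠ 0 ∧ ∀ p : PrimeSpectrum A, a ∉ p.asIdeal →
      p ∈ Set.range (PrimeSpectrum.comap f) := by
  obtain ⟨S, hS⟩ := PrimeSpectrum.exists_constructibleSetData_iff.2
    (PrimeSpectrum.isConstructible_range_comap hf)
  have hbot : (⊥ : PrimeSpectrum A) ∈ Set.range (PrimeSpectrum.comap f) :=
    ⟨⊥, by ext x; simp [map_eq_zero_iff f hinj]⟩
  -- The piece of the image that contains the generic point is open.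
  rw [← hS, PrimeSpectrum.ConstructibleSetData.toSet, Set.mem_iUnion₂] at hbot
  obtain ⟨piece, hpiece, hbot⟩ := hbot
  have hg : ∀ k, piece.g k = 0 := fun k => by simpa using hbot.1 (Set.mem_range_self k)
  refine ⟨piece.f, fun h0 => hbot.2 (by simp [h0]), fun p hp => ?_⟩
  rw [← hS, PrimeSpectrum.ConstructibleSetData.toSet, Set.mem_iUnion₂]
  refine ⟨piece, hpiece, ?_, by simpa using hp⟩
  rintro _ ⟨k, rfl⟩
  simp [hg k]

variable {K : Type*} [Field K] {N M : ℕ}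

theorem exists_forall_eval_eq_zero [IsAlgClosed K] {σ : Type*} [Finite σ]
    {J : Ideal (MvPolynomial σ K)} (hJ : J ≠ ⊤) : ∃ z : σ → K, ∀ f ∈ J, eval z f = 0 := by
  obtain ⟨m, hm, hJm⟩ := J.exists_le_maximal hJ
  obtain ⟨z, rfl⟩ := (isMaximal_iff_eq_vanishingIdeal_singleton (K := K)).1 hm
  exact ⟨z, fun f hf => (mem_vanishingIdeal_singleton_iff z f).1 (hJm hf)⟩

/-- The inclusion of `ℕ^N` in `ℤ^N`. -/
def natExponent (N : ℕ) : (Fin N →₀ ℕ) →+ (Fin N → ℤ) :=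
  ((Nat.castAddMonoidHom ℤ).compLeft (Fin N)).comp Finsupp.coeFnAddHom

theorem natExponent_apply (n : Fin N →₀ ℕ) (j : Fin N) : natExponent N n j = n j := rfl

theorem natExponent_injective (N : ℕ) : Function.Injective (natExponent N) := fun _ _ h =>
  Finsupp.ext fun j => Int.ofNat.inj (congrFun h j)

theorem mem_range_natExponent {α : Fin N → ℤ} : α ∈ Set.range (natExponent N) ↔ 0 ≤ α := by
  refine ⟨?_, fun h => ⟨Finsupp.equivFunOnFinite.symm fun j => (α j).toNat, ?_⟩⟩
  · rintro ⟨n, rfl⟩ j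
    exact Int.natCast_nonneg _
  · ext j
    exact Int.toNat_of_nonneg (h j)

/-- The inclusion of `K[x]` in `K[x*]`. -/
def inclusionX (K : Type*) [Field K] (N : ℕ) : MvPolynomial (Fin N) K →+* Laurent K N :=
  mapDomainRingHom K (natExponent N)

theorem inclusionX_injective : Function.Injective (inclusionX K N) :=
  AddMonoidAlgebra.mapDomain_injective (natExponent_injective N)

theorem inclusionX_monomial (n : Fin N →₀ ℕ) (a : K) :
    inclusionX K N (monomial n a) = single (natExponent N n) a :=
  AddMonoidAlgebra.mapDomain_single

theorem inclusionX_C (a : K) : inclusionX K N (C a) = algebraMap K (Laurent K N) a := by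
  rw [C_apply, inclusionX_monomial, map_zero]
  rfl

theorem inclusionX_X (j : Fin N) :
    inclusionX K N (X j) = single (Pi.single j 1 : Fin N → ℤ) (1 : K) := by
  rw [X, inclusionX_monomial]
  congr 1
  ext k
  simp [natExponent_apply, Finsupp.single_apply, Pi.single_apply, eq_comm]

theorem inclusion_rename (p : MvPolynomial (Fin N) K) :
    inclusion K N M (rename Sum.inl p) = C (inclusionX K N p) := by
  have : (inclusion K N M).comp (rename (R := K) (Sum.inl : Fin N → Fin N ⊕ Fin M)).toRingHom =
      C.comp (inclusionX K N) :=
    ringHom_ext (fun a => by simp [inclusion, inclusionX_C])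
      fun j => by simp [inclusion, inclusionX_X]
  exact RingHom.congr_fun this p

theorem exists_map_inclusionX_eq (p : Polynomial (Laurent K N)) :
    ∃ (γ : Fin N → ℤ) (q : Polynomial (MvPolynomial (Fin N) K)),
      q.map (inclusionX K N) = Polynomial.C (single γ 1) * p := by
  obtain ⟨δ, hδ⟩ := (exponents p).bddBelow
  refine ⟨-δ, exists_map_mapDomainRingHom_eq (natExponent N) (-δ) p fun n α hα => ?_⟩
  rw [mem_range_natExponent, neg_add_eq_sub, sub_nonneg]
  exact hδ (mem_exponents.2 ⟨n, Finsupp.mem_support_iff.1 hα⟩)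

/-- The homomorphism `K[x][T] → K[x, y]`, `T ↦ y_i`; on spectra it is the projection
`(x, y) ↦ (x, y_i)`. -/
def toVariable (K : Type*) [Field K] (N : ℕ) {M : ℕ} (i : Fin M) :
    Polynomial (MvPolynomial (Fin N) K) →+* MvPolynomial (Fin N ⊕ Fin M) K :=
  Polynomial.eval₂RingHom (rename Sum.inl).toRingHom (X (Sum.inr i))

theorem inclusion_toVariable (i : Fin M) (p : Polynomial (MvPolynomial (Fin N) K)) :
    inclusion K N M (toVariable K N i p) = (p.map (inclusionX K N)).eval₂ C (X i) := by
  have : (inclusion K N M).comp (toVariable K N i) =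
      (Polynomial.eval₂RingHom C (X i)).comp (Polynomial.mapRingHom (inclusionX K N)) :=
    Polynomial.ringHom_ext (fun a => by simp [toVariable, inclusion_rename])
      (by simp [toVariable, inclusion])
  exact RingHom.congr_fun this p

theorem eval_toVariable (i : Fin M) (p : Polynomial (MvPolynomial (Fin N) K))
    (z : Fin N ⊕ Fin M → K) :
    eval z (toVariable K N i p) = (p.map (eval (z ∘ Sum.inl))).eval (z (Sum.inr i)) := by
  have : (eval z).comp (toVariable K N i) = (Polynomial.evalRingHom (z (Sum.inr i))).comp
      (Polynomial.mapRingHom (eval (z ∘ Sum.inl))) :=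
    Polynomial.ringHom_ext (fun a => by simp [toVariable, eval_rename])
      (by simp [toVariable])
  exact RingHom.congr_fun this p

theorem finitePresentation_quotientMk_comp_toVariable (i : Fin M)
    (P : Ideal (MvPolynomial (Fin N ⊕ Fin M) K)) :
    ((Ideal.Quotient.mk P).comp (toVariable K N i)).FinitePresentation := by
  refine RingHom.FinitePresentation.of_finiteType.1
    (RingHom.FiniteType.of_comp_finiteType (f := Polynomial.C.comp C) ?_)
  have : ((Ideal.Quotient.mk P).comp (toVariable K N i)).comp (Polynomial.C.comp C) =
      algebraMap K (MvPolynomial (Fin N ⊕ Fin M) K ⧸ P) :=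
    RingHom.ext fun a => by simp [toVariable]; rfl
  rw [this, RingHom.finiteType_algebraMap]
  infer_instance

/-- Every `y_i` is algebraic over `K[x*]` modulo `I`. For ideals that meet `K[x*]` trivially this
is the algebraic form of `N`-admissibility. -/
def IsAlgebraicMod (I : Ideal (LaurentPoly K N M)) : Prop :=
  ∀ i : Fin M, ∃ p : Polynomial (Laurent K N), p ≠ 0 ∧ p.eval₂ C (X i) ∈ I

theorem IsAlgebraicMod.exists_toVariable_mem {I : Ideal (LaurentPoly K N M)}
    (h : IsAlgebraicMod I) (i : Fin M) :
    ∃ p, p ≠ 0 ∧ toVariable K N i p ∈ I.comap (inclusion K N M) := by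
  obtain ⟨p, hp0, hp⟩ := h i
  obtain ⟨γ, q, hq⟩ := exists_map_inclusionX_eq p
  refine ⟨q, ?_, ?_⟩
  · rintro rfl
    rw [Polynomial.map_zero, zero_eq_mul, Polynomial.C_eq_zero] at hq
    exact hq.elim (by simp) hp0
  · rw [Ideal.mem_comap, inclusion_toVariable, hq, Polynomial.eval₂_mul]
    exact I.mul_mem_left _ hp

variable [IsAlgClosed K]

theorem exists_ne_zero_forall_exists_mem_commonZeroes
    {J : Ideal (MvPolynomial (Fin N ⊕ Fin M) K)} {i : Fin M}
    (hJ : ∀ p, toVariable K N i p ∈ J → p = 0) :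
    ∃ a : Polynomial (MvPolynomial (Fin N) K), a ≠ 0 ∧
      ∀ x t, (a.map (eval x)).eval t ≠ 0 → ∃ y, (x, y) ∈ commonZeroes J ∧ y i = t := by
  obtain ⟨P, hP, hJP, hinj⟩ := exists_isPrime_injective_quotientMk_comp _ hJ
  obtain ⟨a, ha0, ha⟩ := exists_ne_zero_forall_mem_range_comap
    (finitePresentation_quotientMk_comp_toVariable i P) hinj
  refine ⟨a, ha0, fun x t hxt => ?_⟩
  let evalAt : Polynomial (MvPolynomial (Fin N) K) →+* K :=
    (Polynomial.evalRingHom t).comp (Polynomial.mapRingHom (eval x))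
  obtain ⟨Q, hQ⟩ := ha ⟨RingHom.ker evalAt, RingHom.ker_isPrime evalAt⟩
    (by simpa [evalAt] using hxt)
  obtain ⟨z, hz⟩ := exists_forall_eval_eq_zero
    (Ideal.IsPrime.ne_top (inferInstance : (Q.asIdeal.comap (Ideal.Quotient.mk P)).IsPrime))
  have hzJ : ∀ f ∈ J, eval z f = 0 := fun f hf => hz f <| by
    rw [Ideal.mem_comap, Ideal.Quotient.eq_zero_iff_mem.2 (hJP hf)]
    exact zero_mem _
  have hz_eval : ∀ p, evalAt p = 0 → (p.map (eval (z ∘ Sum.inl))).eval (z (Sum.inr i)) = 0 :=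
    fun p hp => by
      have hpQ : p ∈ (PrimeSpectrum.comap
        ((Ideal.Quotient.mk P).comp (toVariable K N i)) Q).asIdeal := by rwa [hQ]
      rw [← eval_toVariable]
      exact hz _ hpQ
  have hzx : z ∘ Sum.inl = x := funext fun j => by
    have := hz_eval (Polynomial.C (X j - C (x j))) (by simp [evalAt])
    rwa [Polynomial.map_C, Polynomial.eval_C, map_sub, eval_X, eval_C, sub_eq_zero] at this
  have hzt : z (Sum.inr i) = t := by
    have := hz_eval (Polynomial.X - Polynomial.C (C t)) (by simp [evalAt])
    rwa [Polynomial.map_sub, Polynomial.map_X, Polynomial.map_C, eval_C, Polynomial.eval_sub,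
      Polynomial.eval_X, Polynomial.eval_C, sub_eq_zero] at this
  exact ⟨z ∘ Sum.inr, fun f hf => by simpa [← hzx, Sum.elim_comp_inl_inr] using hzJ f hf, hzt⟩

theorem exists_ne_zero_toVariable_mem_of_finite {J : Ideal (MvPolynomial (Fin N ⊕ Fin M) K)}
    {q : MvPolynomial (Fin N) K} (hq0 : q ≠ 0)
    (hq : ∀ x, eval x q ≠ 0 → {y | (x, y) ∈ commonZeroes J}.Finite) (i : Fin M) :
    ∃ p, p ≠ 0 ∧ toVariable K N i p ∈ J := by
  by_contra! hJ
  obtain ⟨a, ha0, ha⟩ := exists_ne_zero_forall_exists_mem_commonZeroes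
    fun p hp => not_imp_not.1 (hJ p) hp
  obtain ⟨x, hx⟩ : ∃ x, eval x (q * a.leadingCoeff) ≠ 0 := by
    by_contra! hx
    exact mul_ne_zero hq0 (Polynomial.leadingCoeff_ne_zero.2 ha0)
      (MvPolynomial.funext fun x => by simpa using hx x)
  rw [map_mul, mul_ne_zero_iff] at hx
  have hax : a.map (eval x) ≠ 0 := fun h0 => hx.2 <| by
    rw [Polynomial.leadingCoeff, ← Polynomial.coeff_map, h0, Polynomial.coeff_zero]
  exact (Polynomial.finite_setOfPred_isRoot hax).infinite_compl
    (((hq x hx.1).image (Function.eval i)).subset fun t ht => ha x t ht)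

theorem IsNAdmissible.isAlgebraicMod {I : Ideal (LaurentPoly K N M)} (h : IsNAdmissible I) :
    IsAlgebraicMod I := by
  intro i
  obtain ⟨-, q, hq0, hq⟩ := h
  obtain ⟨p, hp0, hp⟩ := exists_ne_zero_toVariable_mem_of_finite hq0 hq i
  rw [Ideal.mem_comap, inclusion_toVariable] at hp
  exact ⟨_, (Polynomial.map_ne_zero_iff inclusionX_injective).2 hp0, hp⟩

theorem IsAlgebraicMod.isNAdmissible {I : Ideal (LaurentPoly K N M)}
    (h : IsAlgebraicMod I) (h0 : ∀ a : Laurent K N, C a ∈ I → a = 0) : IsNAdmissible I := by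
  constructor
  · intro p hp
    have hvanish : rename Sum.inl p ∈
        vanishingIdeal K (zeroLocus K (I.comap (inclusion K N M))) := fun z hz => by
      have := hp (z ∘ Sum.inl) ⟨(z ∘ Sum.inl, z ∘ Sum.inr), fun f hf => by
        simpa [Sum.elim_comp_inl_inr] using hz f hf, rfl⟩
      simpa [aeval_rename] using this
    rw [vanishingIdeal_zeroLocus_eq_radical] at hvanish
    obtain ⟨n, hn⟩ := hvanish
    rw [Ideal.mem_comap, map_pow, inclusion_rename, ← map_pow, ← map_pow] at hn
    exact eq_zero_of_pow_eq_zero ((map_eq_zero_iff _ inclusionX_injective).1 (h0 _ hn))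
  · choose p hp0 hp using h.exists_toVariable_mem
    refine ⟨∏ i, (p i).leadingCoeff, Finset.prod_ne_zero_iff.2 fun i _ => by simpa using hp0 i,
      fun x hx => ?_⟩
    rw [map_prod, Finset.prod_ne_zero_iff] at hx
    have hne : ∀ i, (p i).map (eval x) ≠ 0 := fun i hi => hx i (Finset.mem_univ i) (by
      rw [Polynomial.leadingCoeff, ← Polynomial.coeff_map, hi, Polynomial.coeff_zero])
    refine (Set.Finite.pi fun i => Polynomial.finite_setOfPred_isRoot (hne i)).subset
      fun y hy i _ => ?_
    simpa [eval_toVariable] using hy _ (hp i)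

end Admissibility

section Weights

variable {K : Type*} [Field K] {N M : ℕ} {ω : Fin N → ℝ} {η : Fin M → WithTop ℝ}

/-- The linear form `α ↦ ω · α` on `ℤ^N`. -/
def dot (ω : Fin N → ℝ) : (Fin N → ℤ) →+ ℝ where
  toFun α := ∑ j, ω j * (α j : ℝ)
  map_zero' := by simp
  map_add' α β := by simp [mul_add, Finset.sum_add_distrib]

theorem dot_injective (hω : LinearIndependent ℚ ω) : Function.Injective (dot ω) := by
  refine (injective_iff_map_eq_zero _).2 fun α hα => ?_
  have := Fintype.linearIndependent_iff.1 hω (fun j => (α j : ℚ)) (by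
    rw [← hα]
    simp [dot, Rat.smul_def, mul_comm])
  ext j
  exact_mod_cast this j

/-- The exponent `∑ i, β i • r i` of the power of `x` that `y^β` becomes under `y_i = x^{r_i}`. -/
def shift (r : Fin M → Fin N → ℤ) : (Fin M →₀ ℕ) →+ (Fin N → ℤ) where
  toFun β := ∑ i, β i • r i
  map_zero' := by simp
  map_add' α β := by simp [add_smul, Finset.sum_add_distrib]

theorem shift_apply (r : Fin M → Fin N → ℤ) (β : Fin M →₀ ℕ) :
    shift r β = ∑ i, β i • r i := rfl

theorem weight_eq_top (α : Fin N → ℤ) {β : Fin M →₀ ℕ} {i : Fin M} (hi : η i = ⊤)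
    (hβ : β i ≠ 0) : weight ω η α β = ⊤ := by
  rw [weight, WithTop.add_eq_top, WithTop.sum_eq_top]
  refine Or.inr ⟨i, Finset.mem_univ i, ?_⟩
  rw [hi, WithTop.mul_top]
  exact_mod_cast hβ

theorem weight_eq_coe (α : Fin N → ℤ) {β : Fin M →₀ ℕ} (hβ : ∀ i, η i = ⊤ → β i = 0) :
    weight ω η α β = ((dot ω α + ∑ i, β i * (η i).untopD 0 : ℝ) : WithTop ℝ) := by
  change ((dot ω α : ℝ) : WithTop ℝ) + _ = _
  rw [WithTop.coe_add, WithTop.coe_sum]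
  refine congrArg₂ (· + ·) rfl (Finset.sum_congr rfl fun i _ => ?_)
  cases hi : η i with
  | top => simp [hβ i hi]
  | coe e => simp

theorem OmegaSet.scaledRow_eq_zero (D : OmegaSet K M ω) {i : Fin M} (hi : D.η i = ⊤) :
    scaledRow D.Γ i = 0 := by
  ext j
  simp [scaledRow, D.row_eq_top i hi j]

theorem OmegaSet.entry_ne_top (hω : LinearIndependent ℚ ω) (D : OmegaSet K M ω) {i : Fin M}
    (hi : D.η i ≠ ⊤) (j : Fin N) : D.Γ i j ≠ ⊤ := by
  intro hj
  refine hi (D.dot_eq i hi ▸ WithTop.sum_eq_top.2 ⟨j, Finset.mem_univ j, ?_⟩)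
  rw [hj, WithTop.map_top, WithTop.mul_top]
  exact_mod_cast hω.ne_zero j

theorem OmegaSet.dot_scaledRow (hω : LinearIndependent ℚ ω) (D : OmegaSet K M ω) (i : Fin M) :
    dot ω (scaledRow D.Γ i) = denom D.Γ * (D.η i).untopD 0 := by
  by_cases hi : D.η i = ⊤
  · simp [D.scaledRow_eq_zero hi, hi]
  have hη : D.η i = ((∑ j, ω j * (((D.Γ i j).untopD 0 : ℚ) : ℝ) : ℝ) : WithTop ℝ) := by
    rw [← D.dot_eq i hi, WithTop.coe_sum]
    refine Finset.sum_congr rfl fun j _ => ?_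
    obtain ⟨q, hq⟩ := WithTop.ne_top_iff_exists.1 (D.entry_ne_top hω hi j)
    simp [← hq]
  rw [hη, WithTop.untopD_coe, Finset.mul_sum]
  change ∑ j, ω j * (scaledRow D.Γ i j : ℝ) = _
  refine Finset.sum_congr rfl fun j _ => ?_
  have : (scaledRow D.Γ i j : ℝ) = denom D.Γ * (((D.Γ i j).untopD 0 : ℚ) : ℝ) := by
    exact_mod_cast congrArg (Rat.cast : ℚ → ℝ) (scaledRow_cast D.Γ i j)
  rw [this, mul_left_comm]

theorem OmegaSet.weight_eq (hω : LinearIndependent ℚ ω) (D : OmegaSet K M ω) (α : Fin N → ℤ)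
    {β : Fin M →₀ ℕ} (hβ : ∀ i, D.η i = ⊤ → β i = 0) :
    weight ω D.η α β =
      ((dot ω (denom D.Γ • α + shift (scaledRow D.Γ) β) / denom D.Γ : ℝ) : WithTop ℝ) := by
  have hd : (denom D.Γ : ℝ) ≠ 0 := by exact_mod_cast (denom_pos D.Γ).ne'
  rw [weight_eq_coe α hβ, WithTop.coe_inj, map_add, map_nsmul, shift_apply, map_sum, nsmul_eq_mul,
    add_div, mul_div_cancel_left₀ _ hd, Finset.sum_div]
  refine congrArg₂ (· + ·) rfl (Finset.sum_congr rfl fun i _ => ?_)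
  rw [map_nsmul, D.dot_scaledRow hω, nsmul_eq_mul, mul_left_comm, mul_div_cancel_left₀ _ hd]

theorem polyOrder_le (ω : Fin N → ℝ) (η : Fin M → WithTop ℝ) (f : LaurentPoly K N M)
    {β : Fin M →₀ ℕ} {α : Fin N → ℤ} (h : (f.coeff β).coeff α ≠ 0) :
    polyOrder ω η f ≤ weight ω η α β := by
  refine (Finset.inf_le (mem_support_iff.2 fun h0 => h ?_)).trans
    (Finset.inf_le (Finsupp.mem_support_iff.2 h))
  rw [h0]
  rfl

theorem le_polyOrder {f : LaurentPoly K N M} {w : WithTop ℝ}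
    (h : ∀ β α, (f.coeff β).coeff α ≠ 0 → w ≤ weight ω η α β) : w ≤ polyOrder ω η f :=
  Finset.le_inf fun β _ => Finset.le_inf fun α hα => h β α (Finsupp.mem_support_iff.1 hα)

theorem exists_weight_eq_polyOrder {f : LaurentPoly K N M} (h : polyOrder ω η f ≠ ⊤) :
    ∃ β α, (f.coeff β).coeff α ≠ 0 ∧ weight ω η α β = polyOrder ω η f := by
  by_contra! hne
  have hlt : ∀ β ∈ f.support, ∀ α ∈ (f.coeff β).coeff.support,
      polyOrder ω η f < weight ω η α β := fun β _ α hα =>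
    have hα := Finsupp.mem_support_iff.1 hα
    (polyOrder_le ω η f hα).lt_of_ne (hne β α hα).symm
  refine lt_irrefl (polyOrder ω η f) ?_
  conv_rhs => rw [polyOrder]
  exact (Finset.lt_inf_iff h.lt_top).2 fun β hβ => (Finset.lt_inf_iff h.lt_top).2 (hlt β hβ)

open Classical in
/-- The sum of the terms of weight `w` of `f`. Unlike `initialPart`, it is additive over the terms
of `f`. -/
def weightPart (ω : Fin N → ℝ) (η : Fin M → WithTop ℝ) (w : WithTop ℝ) (f : LaurentPoly K N M) :
    LaurentPoly K N M :=
  ∑ β ∈ f.support, ∑ α ∈ (f.coeff β).coeff.support with weight ω η α β = w,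
    monomial β (single α ((f.coeff β).coeff α))

theorem initialPart_eq_weightPart {f : LaurentPoly K N M} (h : polyOrder ω η f ≠ ⊤) :
    initialPart ω η f = weightPart ω η (polyOrder ω η f) f :=
  if_neg h

theorem weightPart_eq_zero {f : LaurentPoly K N M} {w : WithTop ℝ} (h : w < polyOrder ω η f) :
    weightPart ω η w f = 0 := by
  refine Finset.sum_eq_zero fun β _ => Finset.sum_eq_zero fun α hα => ?_
  rw [Finset.mem_filter, Finsupp.mem_support_iff] at hα
  exact absurd hα.2 (h.trans_le (polyOrder_le ω η f hα.1)).ne'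

theorem evalOne_monomial (c : Fin M → K) (β : Fin M →₀ ℕ) (α : Fin N → ℤ) (k : K) :
    evalOne c (monomial β (single α k)) = k * ∏ i, c i ^ β i := by
  simp [evalOne, Finsupp.prod_fintype]

theorem IsStarting.evalOne_weightPart_eq_zero {I : Ideal (LaurentPoly K N M)}
    {D : OmegaSet K M ω} (hD : IsStarting I D) {f : LaurentPoly K N M} (hf : f ∈ I) {w : ℝ}
    (hw : w ≤ polyOrder ω D.η f) : evalOne D.c (weightPart ω D.η w f) = 0 := by
  obtain hlt | heq := hw.lt_or_eq
  · rw [weightPart_eq_zero hlt, map_zero]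
  · rw [heq, ← initialPart_eq_weightPart (heq ▸ WithTop.coe_ne_top)]
    exact hD.2 _ (Ideal.subset_span (Or.inl ⟨f, hf, rfl⟩))

end Weights

section Power

variable {K : Type*} [Field K] {N M d : ℕ}

/-- The endomorphism `x ↦ x^d` of `K[x*]`. -/
def power (K : Type*) [Field K] (N d : ℕ) : Laurent K N →+* Laurent K N :=
  mapDomainRingHom K (nsmulAddMonoidHom (α := Fin N → ℤ) d)

theorem power_single (d : ℕ) (α : Fin N → ℤ) (k : K) :
    power K N d (single α k) = single (d • α) k :=
  AddMonoidAlgebra.mapDomain_single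

theorem power_injective (hd : d ≠ 0) : Function.Injective (power K N d) :=
  AddMonoidAlgebra.mapDomain_injective (smul_right_injective (Fin N → ℤ) hd)

theorem IsAlgebraicMod.transform {ω : Fin N → ℝ} {I : Ideal (LaurentPoly K N M)}
    (h : IsAlgebraicMod I) (D : OmegaSet K M ω) : IsAlgebraicMod (transform I D) := by
  intro i
  obtain ⟨p, hp0, hp⟩ := h i
  let s : Laurent K N := single (scaledRow D.Γ i) (D.c i)
  refine ⟨Polynomial.taylor s (p.map (power K N (denom D.Γ))), ?_, ?_⟩
  · rw [Ne, (Polynomial.taylor_injective s).eq_iff' (map_zero _),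
      Polynomial.map_eq_zero_iff (power_injective (denom_pos D.Γ).ne')]
    exact hp0
  · have : substitution D (p.eval₂ C (X i)) =
        (Polynomial.taylor s (p.map (power K N (denom D.Γ)))).eval₂ C (X i) := by
      rw [Polynomial.taylor_apply, Polynomial.eval₂_comp, Polynomial.eval₂_map,
        Polynomial.hom_eval₂]
      congr 1
      · ext a <;> simp [substitution, power]
      · simp [substitution, s]
    rw [← this]
    exact Ideal.subset_span ⟨_, hp, rfl⟩

/-- The representative in `{0, …, d - 1}^N` of a residue class modulo `d`. -/
def residueRep (κ : Fin N → Fin d) : Fin N → ℤ := fun j => κ j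

theorem exists_residueRep_add_smul_eq (hd : d ≠ 0) (α : Fin N → ℤ) :
    ∃ (κ : Fin N → Fin d) (γ : Fin N → ℤ), residueRep κ + d • γ = α := by
  have hd' : (0 : ℤ) < d := by exact_mod_cast hd.bot_lt
  have hmod : ∀ j, ((α j % d).toNat : ℤ) = α j % d := fun j =>
    Int.toNat_of_nonneg (Int.emod_nonneg _ hd'.ne')
  refine ⟨fun j => ⟨(α j % d).toNat, ?_⟩, fun j => α j / d, ?_⟩
  · have := Int.emod_lt_of_pos (α j) hd'
    have := hmod j
    omega
  · ext j
    simp only [residueRep, Pi.add_apply, hmod, nsmul_eq_mul]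
    exact Int.emod_add_mul_ediv (α j) d

theorem eq_of_residueRep_add_smul_eq {κ κ' : Fin N → Fin d} {γ γ' : Fin N → ℤ}
    (h : residueRep κ + d • γ = residueRep κ' + d • γ') : κ = κ' := by
  refine funext fun j => Fin.ext ?_
  simpa [residueRep, Int.add_mul_emod_self_left, Int.emod_eq_of_lt] using
    congrArg (· % (d : ℤ)) (congrFun h j)

theorem add_smul_injective (hd : d ≠ 0) (κ : Fin N → ℤ) :
    Function.Injective fun γ : Fin N → ℤ => κ + d • γ := fun _ _ h =>
  smul_right_injective (Fin N → ℤ) hd (add_left_cancel h)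

/-- The additive map `∑ a_α x^α ↦ ∑ a_{κ+dγ} x^γ`, a coordinate map for the basis
`x^κ`, `κ ∈ {0, …, d - 1}^N`, of `K[x*]` as a module over its subring of the `a(x^d)`. -/
def residuePart (hd : d ≠ 0) (κ : Fin N → ℤ) : Laurent K N →+ Laurent K N :=
  AddMonoidAlgebra.comapDomainAddMonoidHom _ (add_smul_injective hd κ)

theorem coeff_residuePart (hd : d ≠ 0) (κ : Fin N → ℤ) (a : Laurent K N) (γ : Fin N → ℤ) :
    (residuePart hd κ a).coeff γ = a.coeff (κ + d • γ) := rfl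

theorem residuePart_power_mul (hd : d ≠ 0) (κ : Fin N → ℤ) (a b : Laurent K N) :
    residuePart hd κ (power K N d a * b) = a * residuePart hd κ b := by
  induction a using AddMonoidAlgebra.induction_linear with
  | zero => simp
  | add a a' h h' => rw [map_add, add_mul, map_add, h, h', add_mul]
  | single α k =>
    ext γ
    rw [power_single, coeff_residuePart, AddMonoidAlgebra.coeff_single_mul_apply,
      AddMonoidAlgebra.coeff_single_mul_apply, coeff_residuePart, smul_add, smul_neg]
    congr 2
    abel

theorem sum_single_mul_power_residuePart (hd : d ≠ 0) (a : Laurent K N) :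
    ∑ κ : Fin N → Fin d, single (residueRep κ) 1 * power K N d (residuePart hd (residueRep κ) a) =
      a := by
  induction a using AddMonoidAlgebra.induction_linear with
  | zero => simp
  | add a b ha hb => simp only [map_add, mul_add, Finset.sum_add_distrib, ha, hb]
  | single α k =>
    obtain ⟨κ, γ, rfl⟩ := exists_residueRep_add_smul_eq hd α
    rw [Finset.sum_eq_single κ]
    · have : residuePart hd (residueRep κ) (single (residueRep κ + d • γ) k) = single γ k :=
        AddMonoidAlgebra.comapDomain_single_map _ (add_smul_injective hd _) γ k
      rw [this, power_single, AddMonoidAlgebra.single_mul_single, one_mul]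
    · intro κ' _ hne
      have : residuePart hd (residueRep κ') (single (residueRep κ + d • γ) k) = 0 := by
        ext γ'
        rw [coeff_residuePart, AddMonoidAlgebra.coeff_single, Finsupp.single_eq_of_ne
          fun h => hne (eq_of_residueRep_add_smul_eq h)]
        rfl
      rw [this, map_zero, mul_zero]
    · simp

/-- `residuePart` applied to the coefficients of a polynomial in `y`. -/
def polyResiduePart (hd : d ≠ 0) (κ : Fin N → ℤ) : LaurentPoly K N M →+ LaurentPoly K N M where
  toFun := AddMonoidAlgebra.map (residuePart hd κ)
  map_zero' := AddMonoidAlgebra.map_zero _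
  map_add' := AddMonoidAlgebra.map_add _

theorem coeff_polyResiduePart (hd : d ≠ 0) (κ : Fin N → ℤ) (f : LaurentPoly K N M)
    (β : Fin M →₀ ℕ) : (polyResiduePart hd κ f).coeff β = residuePart hd κ (f.coeff β) := rfl

theorem polyResiduePart_map_power_mul (hd : d ≠ 0) (κ : Fin N → ℤ) (f g : LaurentPoly K N M) :
    polyResiduePart hd κ (map (power K N d) f * g) = f * polyResiduePart hd κ g := by
  ext1 β
  simp only [coeff_polyResiduePart, coeff_mul, map_sum, coeff_map, residuePart_power_mul]

theorem polyResiduePart_mem (hd : d ≠ 0) (κ : Fin N → ℤ) {I : Ideal (LaurentPoly K N M)}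
    {g : LaurentPoly K N M} (hg : g ∈ I.map (map (σ := Fin M) (power K N d))) :
    polyResiduePart hd κ g ∈ I := by
  suffices ∀ a, polyResiduePart hd κ (a * g) ∈ I by simpa using this 1
  induction hg using Submodule.span_induction with
  | mem _ h =>
    obtain ⟨f, hf, rfl⟩ := h
    intro a
    rw [mul_comm, polyResiduePart_map_power_mul]
    exact I.mul_mem_right _ hf
  | zero => simp
  | add f g _ _ hf hg =>
    intro a
    rw [mul_add, map_add]
    exact I.add_mem (hf a) (hg a)
  | smul b f _ hf =>
    intro a
    rw [smul_eq_mul, ← mul_assoc]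
    exact hf _

theorem sum_single_mul_map_power_polyResiduePart (hd : d ≠ 0) (f : LaurentPoly K N M) :
    ∑ κ : Fin N → Fin d, C (single (residueRep κ) 1) *
      map (power K N d) (polyResiduePart hd (residueRep κ) f) = f := by
  ext1 β
  simp only [coeff_sum, coeff_C_mul, coeff_map, coeff_polyResiduePart,
    sum_single_mul_power_residuePart]

end Power

section Cone

variable {K : Type*} [Field K] {N M : ℕ} {ω : Fin N → ℝ}

/-- The monoid of the exponents of nonnegative `ω`-weight; its algebra over `K` is the ring of the
Laurent polynomials of nonnegative `ω`-order. -/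
def nonnegCone (ω : Fin N → ℝ) : AddSubmonoid (Fin N → ℤ) :=
  (AddSubmonoid.nonneg ℝ).comap (dot ω)

/-- The inclusion of the algebra of `nonnegCone ω` in `K[x*]`. -/
def coneIncl (K : Type*) [Field K] (ω : Fin N → ℝ) :
    AddMonoidAlgebra K (nonnegCone ω) →+* Laurent K N :=
  mapDomainRingHom K (nonnegCone ω).subtype

theorem coneIncl_single (δ : nonnegCone ω) (k : K) :
    coneIncl K ω (single δ k) = single (δ : Fin N → ℤ) k :=
  AddMonoidAlgebra.mapDomain_single

theorem coneIncl_injective : Function.Injective (coneIncl K ω) :=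
  AddMonoidAlgebra.mapDomain_injective Subtype.val_injective

open Classical in
/-- The character of `nonnegCone ω` with the value `0` at the nonzero elements. It is multiplicative
because `0` is the only exponent of weight `0`. -/
def zeroCharacter (K : Type*) [Field K] (hω : LinearIndependent ℚ ω) :
    Multiplicative (nonnegCone ω) →* K where
  toFun δ := if δ.toAdd = 0 then 1 else 0
  map_one' := by simp
  map_mul' δ δ' := by
    have eq_zero_iff (x : nonnegCone ω) : x = 0 ↔ dot ω x = 0 := by
      rw [← map_zero (dot ω), (dot_injective hω).eq_iff]
      exact Subtype.ext_iff
    have h : (δ * δ').toAdd = 0 ↔ δ.toAdd = 0 ∧ δ'.toAdd = 0 := by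
      rw [toAdd_mul, eq_zero_iff, eq_zero_iff, eq_zero_iff, AddSubmonoid.coe_add, map_add]
      exact add_eq_zero_iff_of_nonneg δ.toAdd.2 δ'.toAdd.2
    rw [if_congr h rfl rfl, ite_and]
    split_ifs <;> simp

/-- The constant coefficient of a Laurent polynomial of nonnegative `ω`-order, as a ring
homomorphism. -/
def constCoeff (hω : LinearIndependent ℚ ω) : AddMonoidAlgebra K (nonnegCone ω) →+* K :=
  (AddMonoidAlgebra.lift K K (nonnegCone ω) (zeroCharacter K hω)).toRingHom

open Classical in
theorem constCoeff_single (hω : LinearIndependent ℚ ω) (δ : nonnegCone ω) (k : K) :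
    constCoeff hω (single δ k) = if δ = 0 then k else 0 := by
  simp [constCoeff, zeroCharacter]

theorem coeff_zero_coneIncl (hω : LinearIndependent ℚ ω) (b : AddMonoidAlgebra K (nonnegCone ω)) :
    (coneIncl K ω b).coeff 0 = constCoeff hω b := by
  classical
  induction b using AddMonoidAlgebra.induction_linear with
  | zero => simp
  | add a b ha hb => rw [map_add, map_add, ← ha, ← hb]; rfl
  | single δ k =>
    rw [coneIncl_single, constCoeff_single, AddMonoidAlgebra.coeff_single, Finsupp.single_apply]
    exact if_congr (Subtype.ext_iff (a1 := δ) (a2 := 0)).symm rfl rfl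

theorem exists_map_coneIncl_eq (hω : LinearIndependent ℚ ω) {p : Polynomial (Laurent K N)}
    (hp : p ≠ 0) : ∃ (δ : Fin N → ℤ) (q : Polynomial (AddMonoidAlgebra K (nonnegCone ω))),
      q.map (constCoeff hω) ≠ 0 ∧ q.map (coneIncl K ω) = Polynomial.C (single (-δ) 1) * p := by
  obtain ⟨δ, hδ, hmin⟩ := (exponents p).exists_min_image (dot ω) (exponents_nonempty hp)
  obtain ⟨q, hq⟩ := exists_map_mapDomainRingHom_eq (nonnegCone ω).subtype (-δ) p fun n α hα => by
    refine ⟨⟨-δ + α, ?_⟩, rfl⟩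
    change 0 ≤ dot ω (-δ + α)
    rw [neg_add_eq_sub, map_sub, sub_nonneg]
    exact hmin α (mem_exponents.2 ⟨n, Finsupp.mem_support_iff.1 hα⟩)
  refine ⟨δ, q, fun h => ?_, hq⟩
  obtain ⟨n, hn⟩ := mem_exponents.1 hδ
  have hcoeff : coneIncl K ω (q.coeff n) = single (-δ) 1 * p.coeff n := by
    rw [← Polynomial.coeff_C_mul, ← hq, Polynomial.coeff_map]
    rfl
  have hconst : constCoeff hω (q.coeff n) = (p.coeff n).coeff δ := by
    rw [← coeff_zero_coneIncl, hcoeff, AddMonoidAlgebra.coeff_single_mul_apply, one_mul, neg_neg,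
      add_zero]
  rw [← hconst, ← Polynomial.coeff_map, h, Polynomial.coeff_zero] at hn
  exact hn rfl

theorem exists_eq_single_mul_coneIncl (hω : LinearIndependent ℚ ω) {a : Laurent K N}
    (ha : a ≠ 0) : ∃ (δ : Fin N → ℤ) (b : AddMonoidAlgebra K (nonnegCone ω)),
      constCoeff hω b ≠ 0 ∧ a = single δ 1 * coneIncl K ω b := by
  obtain ⟨δ, q, hq0, hq⟩ := exists_map_coneIncl_eq hω (Polynomial.C_ne_zero.2 ha)
  rw [← map_mul] at hq
  obtain ⟨b, rfl⟩ : ∃ b, Polynomial.C b = q := Polynomial.natDegree_eq_zero.1 (by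
    rw [← Polynomial.natDegree_map_eq_of_injective coneIncl_injective, hq,
      Polynomial.natDegree_C])
  rw [Polynomial.map_C, Polynomial.C_inj] at hq
  refine ⟨δ, b, fun h => hq0 (by rw [Polynomial.map_C, h, map_zero]), ?_⟩
  rw [hq, ← mul_assoc, single_mul_single_neg, one_mul]

/-- The polynomials in `t_i = x^{-r_i} y_i` over the ring of the Laurent polynomials of nonnegative
`ω`-order; the rows `r_i` enter only in `toLaurent`. -/
abbrev NonnegPoly (K : Type*) [Field K] (ω : Fin N → ℝ) (M : ℕ) : Type _ :=
  MvPolynomial (Fin M) (AddMonoidAlgebra K (nonnegCone ω))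

/-- The homomorphism `x^δ ↦ x^δ`, `t_i ↦ x^{-r_i} y_i`. -/
def toLaurent (K : Type*) [Field K] (ω : Fin N → ℝ) (r : Fin M → Fin N → ℤ) :
    NonnegPoly K ω M →+* LaurentPoly K N M :=
  eval₂Hom (C.comp (coneIncl K ω)) fun i => C (single (-r i) 1) * X i

/-- The homomorphism `x^δ ↦ 0` for `δ ≠ 0`, `t_i ↦ c_i`. Under `toLaurent` it replaces `evalOne c`
of the initial part. -/
def residue (hω : LinearIndependent ℚ ω) (c : Fin M → K) : NonnegPoly K ω M →+* K :=
  eval₂Hom (constCoeff hω) c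

theorem toLaurent_C (r : Fin M → Fin N → ℤ) (b : AddMonoidAlgebra K (nonnegCone ω)) :
    toLaurent K ω r (C b) = C (coneIncl K ω b) :=
  eval₂Hom_C _ _ b

theorem toLaurent_X (r : Fin M → Fin N → ℤ) (i : Fin M) :
    toLaurent K ω r (X i) = C (single (-r i) 1) * X i :=
  eval₂Hom_X' _ _ i

theorem residue_C (hω : LinearIndependent ℚ ω) (c : Fin M → K)
    (b : AddMonoidAlgebra K (nonnegCone ω)) : residue hω c (C b) = constCoeff hω b :=
  eval₂Hom_C _ _ b

theorem residue_X (hω : LinearIndependent ℚ ω) (c : Fin M → K) (i : Fin M) :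
    residue hω c (X i) = c i :=
  eval₂Hom_X' _ _ i

theorem toLaurent_monomial (r : Fin M → Fin N → ℤ) (β : Fin M →₀ ℕ) (δ : nonnegCone ω) (k : K) :
    toLaurent K ω r (monomial β (single δ k)) = monomial β (single (δ - shift r β) k) := by
  have prod_single_pow :
      ∏ i, (single (-r i) 1 : Laurent K N) ^ β i = single (-shift r β) 1 := by
    simp only [AddMonoidAlgebra.single_pow, one_pow, AddMonoidAlgebra.prod_single, shift_apply,
      ← Finset.sum_neg_distrib, smul_neg, Finset.prod_const_one]
  rw [monomial_eq, map_mul, toLaurent_C, coneIncl_single, Finsupp.prod_fintype _ _ (by simp),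
    map_prod, monomial_eq, Finsupp.prod_fintype _ _ (by simp), sub_eq_add_neg,
    ← mul_one k, ← AddMonoidAlgebra.single_mul_single, ← prod_single_pow, map_mul, map_prod,
    mul_one, mul_assoc, ← Finset.prod_mul_distrib]
  simp only [map_pow, toLaurent_X, mul_pow]

open Classical in
theorem residue_monomial (hω : LinearIndependent ℚ ω) (c : Fin M → K) (β : Fin M →₀ ℕ)
    (δ : nonnegCone ω) (k : K) :
    residue hω c (monomial β (single δ k)) = if δ = 0 then k * ∏ i, c i ^ β i else 0 := by
  rw [monomial_eq, map_mul, residue_C, constCoeff_single, Finsupp.prod_fintype _ _ (by simp),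
    map_prod, ite_mul, zero_mul]
  simp only [map_pow, residue_X]

theorem monomial_single_induction {A : Type*} [AddCommMonoid A]
    {P : MvPolynomial (Fin M) (AddMonoidAlgebra K A) → Prop} (zero : P 0)
    (add : ∀ f g, P f → P g → P (f + g))
    (monomial_single : ∀ β α k, P (monomial β (single α k)))
    (f : MvPolynomial (Fin M) (AddMonoidAlgebra K A)) : P f := by
  induction f using MvPolynomial.induction_on' with
  | monomial β a =>
    induction a using AddMonoidAlgebra.induction_linear with
    | zero => rwa [map_zero]
    | add a b ha hb => rw [map_add]; exact add _ _ ha hb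
    | single α k => exact monomial_single β α k
  | add f g hf hg => exact add f g hf hg

theorem dot_nonneg_of_coeff_toLaurent_ne_zero (r : Fin M → Fin N → ℤ) (g : NonnegPoly K ω M)
    (β : Fin M →₀ ℕ) (α : Fin N → ℤ) (h : ((toLaurent K ω r g).coeff β).coeff α ≠ 0) :
    0 ≤ dot ω (α + shift r β) := by
  classical
  contrapose! h
  induction g using monomial_single_induction with
  | zero => simp
  | add f g hf hg => simp [hf, hg]
  | monomial_single β' δ k =>
    rw [toLaurent_monomial, coeff_monomial]
    split_ifs with hβ
    · rw [AddMonoidAlgebra.coeff_single, Finsupp.single_eq_of_ne]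
      rintro rfl
      rw [hβ, sub_add_cancel] at h
      exact h.not_ge δ.2
    · rfl

theorem residue_eq_zero_of_toLaurent_mem_span (hω : LinearIndependent ℚ ω) {c : Fin M → K}
    {s : Set (Fin M)} (hc : ∀ i ∈ s, c i = 0) (r : Fin M → Fin N → ℤ) {g : NonnegPoly K ω M}
    (hg : toLaurent K ω r g ∈ Ideal.span (X '' s)) : residue hω c g = 0 := by
  -- The substitution `y_i = c_i x^{r_i}` becomes `t_i = c_i`.
  let θ : LaurentPoly K N M →+* Laurent K N :=
    eval₂Hom (RingHom.id _) fun i => single (r i) (c i)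
  let e : NonnegPoly K ω M →+* AddMonoidAlgebra K (nonnegCone ω) :=
    eval₂Hom (RingHom.id _) fun i => single 0 (c i)
  have hθ : θ.comp (toLaurent K ω r) = (coneIncl K ω).comp e := by
    refine MvPolynomial.ringHom_ext (fun b => ?_) fun i => ?_
    · simp [θ, e, toLaurent_C]
    · simp [θ, e, toLaurent_X, coneIncl_single, AddMonoidAlgebra.single_mul_single]
  have he : residue hω c = (constCoeff hω).comp e := by
    refine MvPolynomial.ringHom_ext (fun b => ?_) fun i => ?_
    · simp [e, residue_C]
    · simp [e, residue_X, constCoeff_single]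
  have hspan : Ideal.span (X '' s) ≤ RingHom.ker θ := by
    rw [Ideal.span_le]
    rintro _ ⟨i, hi, rfl⟩
    simp [θ, hc i hi]
  have heg : e g = 0 := by
    rw [← (coneIncl_injective (K := K) (ω := ω)).eq_iff, map_zero]
    exact (DFunLike.congr_fun hθ g).symm.trans (hspan hg)
  rw [he, RingHom.comp_apply, heg, map_zero]

end Cone

section Lift

variable {K : Type*} [Field K] {N M : ℕ} {ω : Fin N → ℝ}

open Classical in
theorem OmegaSet.exists_toLaurent_sub_monomial_mem (hω : LinearIndependent ℚ ω)
    (D : OmegaSet K M ω) (κ α : Fin N → ℤ) (β : Fin M →₀ ℕ) (k : K)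
    (h : ((dot ω κ / denom D.Γ : ℝ) : WithTop ℝ) ≤ weight ω D.η α β) :
    ∃ g, C (single (-κ) 1) * map (power K N (denom D.Γ)) (monomial β (single α k)) -
        toLaurent K ω (scaledRow D.Γ) g ∈ Ideal.span (X '' {i | D.η i = ⊤}) ∧
      residue hω D.c g = if weight ω D.η α β = ((dot ω κ / denom D.Γ : ℝ) : WithTop ℝ) then
        evalOne D.c (monomial β (single α k)) else 0 := by
  have hd : (0 : ℝ) < denom D.Γ := by exact_mod_cast denom_pos D.Γ
  rw [map_monomial, power_single, C_mul_monomial, AddMonoidAlgebra.single_mul_single, one_mul]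
  by_cases hβ : ∀ i, D.η i = ⊤ → β i = 0
  · rw [D.weight_eq hω α hβ] at h ⊢
    rw [WithTop.coe_le_coe, div_le_div_iff_of_pos_right hd] at h
    set ε := denom D.Γ • α + shift (scaledRow D.Γ) β with hε
    let δ : nonnegCone ω := ⟨ε - κ, by
      change 0 ≤ dot ω (ε - κ)
      rwa [map_sub, sub_nonneg]⟩
    refine ⟨monomial β (single δ k), ?_, ?_⟩
    · have : -κ + denom D.Γ • α = δ - shift (scaledRow D.Γ) β := by
        simp only [δ, hε]
        abel
      rw [toLaurent_monomial, this, sub_self]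
      exact zero_mem _
    · rw [residue_monomial, evalOne_monomial]
      refine if_congr ?_ rfl rfl
      rw [WithTop.coe_inj, div_left_inj' hd.ne', (dot_injective hω).eq_iff,
        ← sub_eq_zero (a := ε)]
      exact Subtype.ext_iff
  · push Not at hβ
    obtain ⟨i, hi, hβi⟩ := hβ
    refine ⟨0, ?_, ?_⟩
    · rw [map_zero, sub_zero, mem_ideal_span_X_image]
      intro β' hβ'
      rw [Finset.mem_singleton.1 (support_monomial_subset hβ')]
      exact ⟨i, hi, hβi⟩
    · rw [weight_eq_top α hi hβi, if_neg WithTop.top_ne_coe, map_zero]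

theorem OmegaSet.exists_toLaurent_sub_mem (hω : LinearIndependent ℚ ω) (D : OmegaSet K M ω)
    (κ : Fin N → ℤ) (f : LaurentPoly K N M)
    (h : ((dot ω κ / denom D.Γ : ℝ) : WithTop ℝ) ≤ polyOrder ω D.η f) :
    ∃ g, C (single (-κ) 1) * map (power K N (denom D.Γ)) f -
        toLaurent K ω (scaledRow D.Γ) g ∈ Ideal.span (X '' {i | D.η i = ⊤}) ∧
      residue hω D.c g = evalOne D.c
        (weightPart ω D.η ((dot ω κ / denom D.Γ : ℝ) : WithTop ℝ) f) := by
  classical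
  choose! g hg hres using fun (β : Fin M →₀ ℕ) (α : Fin N → ℤ)
    (hα : (f.coeff β).coeff α ≠ 0) =>
      D.exists_toLaurent_sub_monomial_mem hω κ α β ((f.coeff β).coeff α)
        (h.trans (polyOrder_le ω D.η f hα))
  refine ⟨∑ β ∈ f.support, ∑ α ∈ (f.coeff β).coeff.support, g β α, ?_, ?_⟩
  · have hf : f = ∑ β ∈ f.support, ∑ α ∈ (f.coeff β).coeff.support,
        monomial β (single α ((f.coeff β).coeff α)) := by
      conv_lhs => rw [f.as_sum]
      refine Finset.sum_congr rfl fun β _ => ?_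
      rw [← map_sum]
      exact congrArg _ (AddMonoidAlgebra.sum_coeff_single _).symm
    conv => enter [2, 1, 2, 2]; rw [hf]
    simp only [map_sum, Finset.mul_sum, ← Finset.sum_sub_distrib]
    exact sum_mem fun β _ => sum_mem fun α hα => hg β α (Finsupp.mem_support_iff.1 hα)
  · simp only [weightPart, map_sum, Finset.sum_filter]
    refine Finset.sum_congr rfl fun β _ => Finset.sum_congr rfl fun α hα => ?_
    rw [hres β α (Finsupp.mem_support_iff.1 hα), apply_ite (evalOne D.c), map_zero]

theorem OmegaSet.le_polyOrder_polyResiduePart (hω : LinearIndependent ℚ ω) (D : OmegaSet K M ω)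
    {h : NonnegPoly K ω M} {f : LaurentPoly K N M}
    (hf : f - toLaurent K ω (scaledRow D.Γ) h ∈ Ideal.span (X '' {i | D.η i = ⊤}))
    (κ : Fin N → ℤ) :
    ((dot ω (-κ) / denom D.Γ : ℝ) : WithTop ℝ) ≤
      polyOrder ω D.η (polyResiduePart (denom_pos D.Γ).ne' κ f) := by
  refine le_polyOrder fun β α hα => ?_
  by_cases hβ : ∀ i, D.η i = ⊤ → β i = 0
  · have hcoeff : f.coeff β = (toLaurent K ω (scaledRow D.Γ) h).coeff β := by
      rw [← sub_eq_zero, ← coeff_sub]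
      by_contra h0
      obtain ⟨i, hi, hβi⟩ := mem_ideal_span_X_image.1 hf β (mem_support_iff.2 h0)
      exact hβi (hβ i hi)
    rw [coeff_polyResiduePart, coeff_residuePart, hcoeff] at hα
    have := dot_nonneg_of_coeff_toLaurent_ne_zero _ h β _ hα
    rw [D.weight_eq hω α hβ, WithTop.coe_le_coe]
    gcongr
    rw [add_assoc, map_add] at this
    rw [map_neg]
    linarith
  · push Not at hβ
    obtain ⟨i, hi, hβi⟩ := hβ
    rw [weight_eq_top α hi hβi]
    exact le_top

theorem IsStarting.residue_eq_zero (hω : LinearIndependent ℚ ω) {I : Ideal (LaurentPoly K N M)}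
    {D : OmegaSet K M ω} (hD : IsStarting I D) {h : NonnegPoly K ω M}
    (hh : toLaurent K ω (scaledRow D.Γ) h ∈
      I.map (map (σ := Fin M) (power K N (denom D.Γ))) ⊔ Ideal.span (X '' {i | D.η i = ⊤})) :
    residue hω D.c h = 0 := by
  obtain ⟨f, hf, e, he, hfe⟩ := Submodule.mem_sup.1 hh
  have hfh : f - toLaurent K ω (scaledRow D.Γ) h ∈ Ideal.span (X '' {i | D.η i = ⊤}) := by
    rw [← hfe, sub_add_cancel_left]
    exact neg_mem he
  have hd := (denom_pos D.Γ).ne'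
  have hle := fun κ : Fin N → Fin (denom D.Γ) =>
    D.le_polyOrder_polyResiduePart hω hfh (residueRep κ)
  choose g hg hres using fun κ => D.exists_toLaurent_sub_mem hω _ _ (hle κ)
  have hsum : f - toLaurent K ω (scaledRow D.Γ) (∑ κ, g κ) ∈
      Ideal.span (X '' {i | D.η i = ⊤}) := by
    conv => enter [2, 1]; rw [← sum_single_mul_map_power_polyResiduePart hd f]
    rw [map_sum, ← Finset.sum_sub_distrib]
    exact sum_mem fun κ _ => by simpa only [neg_neg] using hg κ
  have hdiff : residue hω D.c (∑ κ, g κ - h) = 0 := by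
    refine residue_eq_zero_of_toLaurent_mem_span hω D.c_eq_zero (scaledRow D.Γ) ?_
    rw [map_sub, ← sub_sub_sub_cancel_left _ _ f]
    exact sub_mem hfh hsum
  rw [map_sub, map_sum, Finset.sum_eq_zero fun κ _ => ?_, zero_sub, neg_eq_zero] at hdiff
  · exact hdiff
  · rw [hres, hD.evalOne_weightPart_eq_zero (polyResiduePart_mem hd _ hf) (hle κ)]

end Lift

section Valuations

variable {L Γ₀ : Type*} [Field L] [LinearOrderedCommGroupWithZero Γ₀] (v : Valuation L Γ₀)

theorem exists_map_coeff_mul_pow_eq {p : Polynomial L} (hp : p ≠ 0) {e : L} (he : p.eval e = 0)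
    (he0 : e ≠ 0) : ∃ i ∈ p.support, ∃ j ∈ p.support, i < j ∧
      v (p.coeff i * e ^ i) = v (p.coeff j * e ^ j) := by
  obtain ⟨i, hi, hmax⟩ := p.support.exists_max_image (fun i => v (p.coeff i * e ^ i))
    (Polynomial.support_nonempty.2 hp)
  by_contra! hne
  have hi0 : v (p.coeff i * e ^ i) ≠ 0 :=
    v.ne_zero_iff.2 (mul_ne_zero (Polynomial.mem_support_iff.1 hi) (pow_ne_zero _ he0))
  have hlt : v (∑ j ∈ p.support.erase i, p.coeff j * e ^ j) < v (p.coeff i * e ^ i) := by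
    refine v.map_sum_lt hi0 fun j hj => ?_
    obtain ⟨hji, hj⟩ := Finset.mem_erase.1 hj
    refine (hmax j hj).lt_of_ne fun h => ?_
    obtain h' | h' := hji.lt_or_gt
    · exact hne j hj i hi h' h
    · exact hne i hi j hj h' h.symm
  rw [Polynomial.eval_eq_sum, Polynomial.sum_def, ← Finset.add_sum_erase _ _ hi,
    add_eq_zero_iff_eq_neg] at he
  rw [he, Valuation.map_neg] at hlt
  exact hlt.ne rfl

variable {v}

theorem map_le_one_of_map_sub_lt_one {x y : L} (hy : v y ≤ 1) (hxy : v (x - y) < 1) : v x ≤ 1 := by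
  rw [← sub_add_cancel x y]
  exact v.map_add_le hxy.le hy

theorem map_mul_sub_mul_lt_one {x x' y y' : L} (hx' : v x' ≤ 1) (hy' : v y' ≤ 1)
    (hx : v (x - x') < 1) (hy : v (y - y') < 1) : v (x * y - x' * y') < 1 := by
  have hmul : x * y - x' * y' = (x - x') * y + x' * (y - y') := by ring
  rw [hmul]
  refine v.map_add_lt ?_ ?_ <;> rw [map_mul]
  · exact mul_lt_one_of_nonneg_of_lt_one_left zero_le hx (map_le_one_of_map_sub_lt_one hy' hy)
  · exact mul_lt_one_of_nonneg_of_lt_one_right hx' zero_le hy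

theorem exists_map_sub_lt_one_of_map_eval₂_lt_one {K : Type*} [Field K] [IsAlgClosed K]
    {κ : K →+* L} (hκ : ∀ k, k ≠ 0 → v (κ k) = 1) {q : Polynomial K} (hq : q ≠ 0) {τ : L}
    (h : v (q.eval₂ κ τ) < 1) : ∃ k, v (τ - κ k) < 1 := by
  rw [(IsAlgClosed.splits q).eq_prod_roots, Polynomial.eval₂_mul, Polynomial.eval₂_C,
    ← Polynomial.coe_eval₂RingHom, map_multiset_prod, map_mul,
    hκ _ (Polynomial.leadingCoeff_ne_zero.2 hq), one_mul, map_multiset_prod, Multiset.map_map,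
    Multiset.map_map] at h
  by_contra! hall
  refine h.not_ge (Multiset.one_le_prod fun x hx => ?_)
  obtain ⟨k, -, rfl⟩ := Multiset.mem_map.1 hx
  simpa using hall k

theorem exists_valuationSubring_of_ker_le {B k : Type*} [CommRing B] [Field k] {φ : B →+* L}
    {ρ : B →+* k} (h : RingHom.ker φ ≤ RingHom.ker ρ) : ∃ V : ValuationSubring L,
      (∀ g, V.valuation (φ g) ≤ 1) ∧ ∀ g, ρ g = 0 → V.valuation (φ g) < 1 := by
  have hsurj : Function.Surjective φ.rangeRestrict := φ.rangeRestrict_surjective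
  have hne : (RingHom.ker ρ).map φ.rangeRestrict ≠ ⊤ := by
    rw [Ne, Ideal.eq_top_iff_one, Ideal.mem_map_iff_of_surjective _ hsurj]
    rintro ⟨g, hg, hg1⟩
    have hker : 1 - g ∈ RingHom.ker φ := by
      rw [RingHom.mem_ker, map_sub, map_one, sub_eq_zero]
      exact congrArg Subtype.val hg1.symm
    have := add_mem (h hker) hg
    rw [sub_add_cancel, RingHom.mem_ker, map_one] at this
    exact one_ne_zero this
  obtain ⟨V, hV, hV'⟩ := Ideal.image_subset_nonunits_valuationSubring _ hne
  refine ⟨V, fun g => (V.valuation_le_one_iff _).2 (hV ⟨g, rfl⟩), fun g hg => ?_⟩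
  exact V.mem_nonunits_iff.1 (hV' ⟨_, Ideal.mem_map_of_mem _ hg, rfl⟩)

end Valuations

section Centred

variable {K : Type*} [Field K] {N M : ℕ} {ω : Fin N → ℝ} {L Γ₀ : Type*} [Field L]
  [LinearOrderedCommGroupWithZero Γ₀] {ψ : Laurent K N →+* L} {v : Valuation L Γ₀}

/-- The valuation `v` of `L` is compatible, along `ψ`, with the `ω`-order of `K[x*]`. -/
structure IsCentred (ω : Fin N → ℝ) (ψ : Laurent K N →+* L) (v : Valuation L Γ₀) : Prop where
  map_single_le_one : ∀ δ k, 0 ≤ dot ω δ → v (ψ (single δ k)) ≤ 1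
  map_single_lt_one : ∀ δ k, 0 < dot ω δ → v (ψ (single δ k)) < 1

theorem map_single_mul_map_single_neg (v : Valuation L Γ₀) (ψ : Laurent K N →+* L)
    (δ : Fin N → ℤ) : v (ψ (single δ 1)) * v (ψ (single (-δ) 1)) = 1 := by
  rw [← map_mul, ← map_mul, single_mul_single_neg, map_one, map_one]

namespace IsCentred

theorem map_single_zero_le_one (h : IsCentred ω ψ v) (k : K) : v (ψ (single 0 k)) ≤ 1 :=
  h.map_single_le_one 0 k (map_zero (dot ω)).ge

theorem map_single_zero (h : IsCentred ω ψ v) {k : K} (hk : k ≠ 0) : v (ψ (single 0 k)) = 1 := by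
  have hmul : v (ψ (single 0 k)) * v (ψ (single 0 k⁻¹)) = 1 := by
    rw [← map_mul, ← map_mul, AddMonoidAlgebra.single_mul_single, mul_inv_cancel₀ hk, add_zero,
      ← AddMonoidAlgebra.one_def, map_one, map_one]
  refine (h.map_single_zero_le_one k).antisymm (le_of_not_gt fun hlt => ?_)
  exact (mul_lt_one_of_nonneg_of_lt_one_left zero_le hlt (h.map_single_zero_le_one _)).ne hmul

theorem dot_pos (h : IsCentred ω ψ v) {δ : Fin N → ℤ} (hδ : v (ψ (single δ 1)) < 1) :
    0 < dot ω δ := by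
  by_contra! hle
  have hneg := h.map_single_le_one (-δ) 1 (by rwa [map_neg, neg_nonneg])
  exact (mul_lt_one_of_nonneg_of_lt_one_left zero_le hδ hneg).ne
    (map_single_mul_map_single_neg v ψ δ)

theorem map_coneIncl_sub_lt_one (hω : LinearIndependent ℚ ω) (h : IsCentred ω ψ v)
    (b : AddMonoidAlgebra K (nonnegCone ω)) :
    v (ψ (coneIncl K ω b) - ψ (single 0 (constCoeff hω b))) < 1 := by
  classical
  induction b using AddMonoidAlgebra.induction_linear with
  | zero => simp
  | add a b ha hb =>
    simp only [map_add, AddMonoidAlgebra.single_add, add_sub_add_comm]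
    exact v.map_add_lt ha hb
  | single δ k =>
    rw [coneIncl_single, constCoeff_single]
    split_ifs with hδ
    · simp [hδ]
    · rw [AddMonoidAlgebra.single_zero, map_zero, sub_zero]
      refine h.map_single_lt_one δ k (lt_of_le_of_ne δ.2 fun h0 => hδ (Subtype.ext ?_))
      exact dot_injective hω (h0.symm.trans (map_zero _).symm)

theorem exists_map_eq (hω : LinearIndependent ℚ ω) (h : IsCentred ω ψ v) {a : Laurent K N}
    (ha : a ≠ 0) : ∃ δ, v (ψ a) = v (ψ (single δ 1)) := by
  obtain ⟨δ, b, hb, rfl⟩ := exists_eq_single_mul_coneIncl hω ha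
  have hb1 : v (ψ (coneIncl K ω b)) = 1 := by
    rw [← h.map_single_zero hb]
    refine Valuation.map_eq_of_sub_lt v ?_
    rw [h.map_single_zero hb]
    exact h.map_coneIncl_sub_lt_one hω b
  exact ⟨δ, by rw [map_mul, map_mul, hb1, mul_one]⟩

theorem injective (hω : LinearIndependent ℚ ω) (h : IsCentred ω ψ v) : Function.Injective ψ := by
  refine (injective_iff_map_eq_zero ψ).2 fun a ha => by_contra fun ha0 => ?_
  obtain ⟨δ, hδ⟩ := h.exists_map_eq hω ha0
  rw [ha, map_zero] at hδ
  exact left_ne_zero_of_mul_eq_one (map_single_mul_map_single_neg v ψ δ) hδ.symm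

theorem exists_pow_eq (hω : LinearIndependent ℚ ω) (h : IsCentred ω ψ v)
    {p : Polynomial (Laurent K N)} (hp : p ≠ 0) {e : L} (he : p.eval₂ ψ e = 0) (he0 : e ≠ 0) :
    ∃ n : ℕ, 0 < n ∧ ∃ γ, v e ^ n = v (ψ (single γ 1)) := by
  have hψ := h.injective hω
  obtain ⟨i, hi, j, hj, hij, heq⟩ := exists_map_coeff_mul_pow_eq v
    ((Polynomial.map_ne_zero_iff hψ).2 hp) (by rwa [Polynomial.eval_map]) he0
  rw [Polynomial.mem_support_iff, Polynomial.coeff_map, map_ne_zero_iff ψ hψ] at hi hj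
  obtain ⟨δ, hδ⟩ := h.exists_map_eq hω hi
  obtain ⟨δ', hδ'⟩ := h.exists_map_eq hω hj
  refine ⟨j - i, Nat.sub_pos_of_lt hij, δ - δ', ?_⟩
  rw [Polynomial.coeff_map, Polynomial.coeff_map, map_mul, map_mul, hδ, hδ', map_pow, map_pow,
    ← Nat.sub_add_cancel hij.le, pow_add, ← mul_assoc] at heq
  have hquot : v (ψ (single δ 1)) = v (ψ (single δ' 1)) * v e ^ (j - i) :=
    mul_right_cancel₀ (pow_ne_zero _ (v.ne_zero_iff.2 he0)) heq
  rw [sub_eq_add_neg, ← one_mul (1 : K), ← AddMonoidAlgebra.single_mul_single, map_mul, map_mul,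
    hquot, mul_right_comm, map_single_mul_map_single_neg, one_mul]

theorem exists_residue [IsAlgClosed K] (hω : LinearIndependent ℚ ω) (h : IsCentred ω ψ v)
    {p : Polynomial (Laurent K N)} (hp : p ≠ 0) {τ : L} (hτ : p.eval₂ ψ τ = 0) (hτ1 : v τ ≤ 1) :
    ∃ k : K, v (τ - ψ (single 0 k)) < 1 := by
  obtain ⟨δ, q, hq0, hq⟩ := exists_map_coneIncl_eq hω hp
  let κ : K →+* L := ψ.comp AddMonoidAlgebra.singleZeroRingHom
  have heval : q.eval₂ (ψ.comp (coneIncl K ω)) τ = 0 := by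
    rw [← Polynomial.eval₂_map, hq, Polynomial.eval₂_mul, hτ, mul_zero]
  have hdiff : v (q.eval₂ (ψ.comp (coneIncl K ω)) τ - q.eval₂ (κ.comp (constCoeff hω)) τ) < 1 := by
    rw [Polynomial.eval₂_eq_sum_range, Polynomial.eval₂_eq_sum_range, ← Finset.sum_sub_distrib]
    refine v.map_sum_lt one_ne_zero fun i _ => ?_
    rw [← sub_mul, map_mul, map_pow]
    exact mul_lt_one_of_nonneg_of_lt_one_left zero_le (h.map_coneIncl_sub_lt_one hω _)
      (pow_le_one' hτ1 i)
  rw [heval, zero_sub, Valuation.map_neg, ← Polynomial.eval₂_map] at hdiff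
  exact exists_map_sub_lt_one_of_map_eval₂_lt_one (κ := κ) (fun k => h.map_single_zero) hq0 hdiff

end IsCentred

/-- In `L`, where `x^{1/d}` with `d = dΓ` is given by `ψ x`, the point `y` has the leading terms
`y_i ∼ c_i x^{Γ_{i,*}}` prescribed by the `ω`-set `D`. -/
structure HasLeadingTerms (D : OmegaSet K M ω) (ψ : Laurent K N →+* L) (v : Valuation L Γ₀)
    (y : Fin M → L) : Prop where
  isCentred : IsCentred ω ψ v
  eq_zero : ∀ i, D.η i = ⊤ → y i = 0
  map_sub_lt_one : ∀ i, v (ψ (single (-scaledRow D.Γ i) 1) * y i - ψ (single 0 (D.c i))) < 1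

theorem HasLeadingTerms.map_eval₂_toLaurent_sub_lt_one (hω : LinearIndependent ℚ ω)
    {D : OmegaSet K M ω} {y : Fin M → L} (h : HasLeadingTerms D ψ v y) (g : NonnegPoly K ω M) :
    v ((toLaurent K ω (scaledRow D.Γ) g).eval₂ ψ y - ψ (single 0 (residue hω D.c g))) < 1 := by
  induction g using MvPolynomial.induction_on with
  | C b =>
    rw [toLaurent_C, eval₂_C, residue_C]
    exact h.isCentred.map_coneIncl_sub_lt_one hω b
  | add f g hf hg =>
    rw [map_add, eval₂_add, map_add, AddMonoidAlgebra.single_add, map_add, add_sub_add_comm]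
    exact v.map_add_lt hf hg
  | mul_X f i hf =>
    rw [map_mul, eval₂_mul, map_mul, toLaurent_X, eval₂_mul, eval₂_C, eval₂_X, residue_X,
      ← add_zero (0 : Fin N → ℤ), ← AddMonoidAlgebra.single_mul_single, map_mul]
    exact map_mul_sub_mul_lt_one (h.isCentred.map_single_zero_le_one _)
      (h.isCentred.map_single_zero_le_one _) hf (h.map_sub_lt_one i)

theorem isStarting_of_evalOne_initialPart {I : Ideal (LaurentPoly K N M)} {D : OmegaSet K M ω}
    (h : ∀ f ∈ I, evalOne D.c (initialPart ω D.η f) = 0) : IsStarting I D := by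
  have hle : initialIdeal ω D.η I ≤ RingHom.ker (evalOne (N := N) D.c) := by
    refine Ideal.span_le.2 ?_
    rintro _ (⟨f, hf, rfl⟩ | ⟨i, hi, rfl⟩)
    · exact h f hf
    · simp [evalOne, RingHom.mem_ker, D.c_eq_zero i hi]
  refine ⟨fun a α β ha hβ hmem => ?_, fun f hf => hle hf⟩
  have heval := hle hmem
  rw [RingHom.mem_ker, evalOne_monomial] at heval
  refine mul_ne_zero ha (Finset.prod_ne_zero_iff.2 fun i _ => ?_) heval
  by_cases hi : D.η i = ⊤
  · simp [hβ i hi]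
  · exact pow_ne_zero _ (D.c_ne_zero i hi)

theorem HasLeadingTerms.isStarting (hω : LinearIndependent ℚ ω) {D : OmegaSet K M ω}
    {y : Fin M → L} (h : HasLeadingTerms D ψ v y) {I : Ideal (LaurentPoly K N M)}
    (hI : ∀ f ∈ I, f.eval₂ (ψ.comp (power K N (denom D.Γ))) y = 0) : IsStarting I D := by
  refine isStarting_of_evalOne_initialPart fun f hf => ?_
  by_cases htop : polyOrder ω D.η f = ⊤
  · rw [initialPart, if_pos htop, map_zero]
  obtain ⟨β, α, -, hw⟩ := exists_weight_eq_polyOrder htop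
  have hβ : ∀ i, D.η i = ⊤ → β i = 0 := by
    by_contra! ⟨i, hi, hβi⟩
    exact htop (hw ▸ weight_eq_top α hi hβi)
  rw [D.weight_eq hω α hβ] at hw
  obtain ⟨g, hg, hres⟩ := D.exists_toLaurent_sub_mem hω _ f hw.le
  have hspan : Ideal.span (X '' {i | D.η i = ⊤}) ≤ RingHom.ker (eval₂Hom ψ y) := by
    rw [Ideal.span_le]
    rintro _ ⟨i, hi, rfl⟩
    simp [RingHom.mem_ker, h.eq_zero i hi]
  have heval : (toLaurent K ω (scaledRow D.Γ) g).eval₂ ψ y = 0 := by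
    have := hspan hg
    rwa [RingHom.mem_ker, map_sub, map_mul, coe_eval₂Hom, eval₂_map, hI f hf, mul_zero, zero_sub,
      neg_eq_zero] at this
  have hlt := h.map_eval₂_toLaurent_sub_lt_one hω g
  rw [heval, zero_sub, Valuation.map_neg, hres, hw, ← initialPart_eq_weightPart htop] at hlt
  by_contra hne
  exact hlt.ne (h.isCentred.map_single_zero hne)

end Centred

section Points

variable {K : Type*} [Field K] {N M : ℕ} {ω : Fin N → ℝ}

theorem exists_ringHom_isAlgClosed.{u} {A : Type u} [CommRing A] (P : Ideal A) [P.IsPrime] :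
    ∃ (L : Type u) (_ : Field L) (_ : IsAlgClosed L) (φ : A →+* L), RingHom.ker φ = P := by
  refine ⟨AlgebraicClosure (FractionRing (A ⧸ P)), inferInstance, inferInstance,
    (algebraMap (A ⧸ P) _).comp (Ideal.Quotient.mk P), Ideal.ext fun f => ?_⟩
  rw [RingHom.mem_ker, RingHom.comp_apply,
    IsScalarTower.algebraMap_apply (A ⧸ P) (FractionRing (A ⧸ P)), map_eq_zero,
    FaithfulSMul.algebraMap_eq_zero_iff, Ideal.Quotient.eq_zero_iff_mem]

theorem hasLeadingTerms_of_residue {L Γ₀ : Type*} [Field L] [LinearOrderedCommGroupWithZero Γ₀]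
    {v : Valuation L Γ₀} (hω : LinearIndependent ℚ ω) (D : OmegaSet K M ω)
    {φ : LaurentPoly K N M →+* L} (hX : ∀ i, D.η i = ⊤ → φ (X i) = 0)
    (hle : ∀ g, v (φ (toLaurent K ω (scaledRow D.Γ) g)) ≤ 1)
    (hlt : ∀ g, residue hω D.c g = 0 → v (φ (toLaurent K ω (scaledRow D.Γ) g)) < 1) :
    HasLeadingTerms D (φ.comp C) v fun i => φ (X i) where
  isCentred :=
    { map_single_le_one := fun δ k hδ => by
        simpa only [toLaurent_C, coneIncl_single, RingHom.comp_apply] using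
          hle (C (single ⟨δ, hδ⟩ k))
      map_single_lt_one := fun δ k hδ => by
        have hres : residue hω D.c (C (single ⟨δ, hδ.le⟩ k)) = 0 := by
          rw [residue_C, constCoeff_single, if_neg]
          refine fun h => hδ.ne' ?_
          rw [show δ = 0 from congrArg Subtype.val h, map_zero]
        simpa only [toLaurent_C, coneIncl_single, RingHom.comp_apply] using hlt _ hres }
  eq_zero := hX
  map_sub_lt_one := fun i => by
    have hres : residue hω D.c (X i - C (single 0 (D.c i))) = 0 := by
      rw [map_sub, residue_X, residue_C, constCoeff_single, if_pos rfl, sub_self]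
    simpa only [map_sub, toLaurent_X, toLaurent_C, coneIncl_single, map_mul, RingHom.comp_apply,
      ZeroMemClass.coe_zero] using hlt _ hres

theorem IsStarting.exists_hasLeadingTerms.{u} {K : Type u} [Field K] {D : OmegaSet K M ω}
    (hω : LinearIndependent ℚ ω) {I : Ideal (LaurentPoly K N M)} (hD : IsStarting I D) :
    ∃ (L : Type u) (_ : Field L) (_ : IsAlgClosed L) (ψ : Laurent K N →+* L) (y : Fin M → L)
      (V : ValuationSubring L), HasLeadingTerms D ψ V.valuation y ∧
        ∀ f ∈ I, f.eval₂ (ψ.comp (power K N (denom D.Γ))) y = 0 := by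
  let J := I.map (map (σ := Fin M) (power K N (denom D.Γ))) ⊔ Ideal.span (X '' {i | D.η i = ⊤})
  let S := ((nonZeroDivisors K).comap (residue hω D.c)).map (toLaurent K ω (scaledRow D.Γ))
  have hJS : Disjoint (J : Set (LaurentPoly K N M)) S := by
    rw [Set.disjoint_left]
    rintro _ hJ ⟨g, hg, rfl⟩
    exact nonZeroDivisors.ne_zero hg (hD.residue_eq_zero hω hJ)
  obtain ⟨P, hP, hJP, hPS⟩ := Ideal.exists_le_prime_disjoint J S hJS
  have hPS' : ∀ g, residue hω D.c g ≠ 0 → toLaurent K ω (scaledRow D.Γ) g ∉ P := fun g hg hgP =>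
    Set.disjoint_left.1 hPS hgP ⟨g, mem_nonZeroDivisors_of_ne_zero hg, rfl⟩
  obtain ⟨L, _, _, φ, rfl⟩ := exists_ringHom_isAlgClosed P
  obtain ⟨V, hle, hlt⟩ := exists_valuationSubring_of_ker_le
    (φ := φ.comp (toLaurent K ω (scaledRow D.Γ))) (ρ := residue hω D.c)
    fun g hg => by_contra fun h => hPS' g h hg
  refine ⟨L, _, ‹_›, φ.comp C, fun i => φ (X i), V,
    hasLeadingTerms_of_residue hω D (fun i hi => ?_) hle hlt, fun f hf => ?_⟩
  · exact hJP (Ideal.mem_sup_right (Ideal.subset_span ⟨i, hi, rfl⟩))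
  · have h := hJP (Ideal.mem_sup_left (Ideal.mem_map_of_mem _ hf))
    rw [RingHom.mem_ker, ← eval₂_eta (map _ f), eval₂_comp_left] at h
    rwa [← eval₂_map]

end Points

section LeadingTerms

variable {K : Type*} [Field K] {N M : ℕ} {ω : Fin N → ℝ}

theorem exists_omegaSet_nsmul_scaledRow_eq (ω : Fin N → ℝ) (s : Set (Fin M)) {n : Fin M → ℕ}
    (hn : ∀ i, 0 < n i) (γ : Fin M → Fin N → ℤ) :
    ∃ D : OmegaSet K M ω, (∀ i, D.η i = ⊤ ↔ i ∈ s) ∧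
      ∀ i ∉ s, n i • scaledRow D.Γ i = denom D.Γ • γ i := by
  classical
  let D : OmegaSet K M ω :=
    { η := fun i => if i ∈ s then ⊤ else ((dot ω (γ i) / n i : ℝ) : WithTop ℝ)
      Γ := fun i j => if i ∈ s then ⊤ else ((γ i j / n i : ℚ) : WithTop ℚ)
      c := fun i => if i ∈ s then 0 else 1
      dot_eq := fun i hi => by
        have his : i ∉ s := fun his => hi (if_pos his)
        simp only [if_neg his, WithTop.map_coe, ← WithTop.coe_mul, ← WithTop.coe_sum, dot,
          AddMonoidHom.coe_mk, ZeroHom.coe_mk, Finset.sum_div, mul_div_assoc, Rat.cast_div,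
          Rat.cast_intCast, Rat.cast_natCast]
      row_eq_top := fun i hi j => if_pos (by simpa using hi)
      c_ne_zero := by simp
      c_eq_zero := by simp }
  refine ⟨D, fun i => by simp [D], fun i hi => funext fun j => ?_⟩
  have hrow := scaledRow_cast D.Γ i j
  have hentry : (D.Γ i j).untopD 0 = γ i j / n i := by simp [D, hi]
  rw [hentry, mul_div_assoc', eq_div_iff (Nat.cast_ne_zero.2 (hn i).ne'), mul_comm] at hrow
  simp only [Pi.smul_apply, nsmul_eq_mul]
  exact_mod_cast hrow

variable {L Γ₀ : Type*} [Field L] [LinearOrderedCommGroupWithZero Γ₀] {v : Valuation L Γ₀}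

theorem exists_comp_power_eq [IsAlgClosed L] (ψ : Laurent K N →+* L) {d : ℕ} (hd : 0 < d) :
    ∃ ξ : Laurent K N →+* L, ξ.comp (power K N d) = ψ := by
  let U : (Fin N → ℤ) →+ Additive Lˣ := AddMonoidHom.toMultiplicativeLeft.symm
    ((ψ : Laurent K N →* L).comp (AddMonoidAlgebra.of K (Fin N → ℤ))).toHomUnits
  let b := Pi.basisFun ℤ (Fin N)
  have hroot : ∀ j, ∃ u : Additive Lˣ, d • u = U (b j) := fun j => by
    obtain ⟨y, hy⟩ := IsAlgClosed.exists_pow_nat_eq ((U (b j)).toMul : L) hd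
    have hy0 : y ≠ 0 := by
      rintro rfl
      exact (U (b j)).toMul.ne_zero (hy ▸ zero_pow hd.ne')
    exact ⟨.ofMul (Units.mk0 y hy0), congrArg Additive.ofMul (Units.ext hy)⟩
  choose u hu using hroot
  let W := b.constr ℤ u
  have hW : d • W = U.toIntLinearMap := b.ext fun j => by
    rw [LinearMap.smul_apply, b.constr_basis, hu, AddMonoidHom.coe_toIntLinearMap]
  refine ⟨AddMonoidAlgebra.liftNCRingHom (ψ.comp AddMonoidAlgebra.singleZeroRingHom)
    ((Units.coeHom L).comp (AddMonoidHom.toMultiplicativeLeft W.toAddMonoidHom))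
    fun _ _ => Commute.all _ _, AddMonoidAlgebra.ringHom_ext (fun k => ?_) fun α => ?_⟩
  · simp [power_single]
  · rw [RingHom.comp_apply, power_single, AddMonoidAlgebra.liftNCRingHom_single, map_one, one_mul]
    have hα : W (d • α) = U α := by
      rw [map_nsmul]
      exact LinearMap.congr_fun hW α
    exact congrArg (fun x : Additive Lˣ => (x.toMul : L)) hα

theorem IsCentred.of_comp_power {ξ : Laurent K N →+* L} {d : ℕ} (hd : 0 < d)
    (h : IsCentred ω (ξ.comp (power K N d)) v) : IsCentred ω ξ v := by
  have hpow : ∀ δ k, v (ξ (single δ k)) ^ d = v (ξ.comp (power K N d) (single δ (k ^ d))) :=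
    fun δ k => by
      rw [RingHom.comp_apply, power_single, ← AddMonoidAlgebra.single_pow, map_pow, map_pow]
  refine ⟨fun δ k hδ => ?_, fun δ k hδ => ?_⟩
  · rw [← pow_le_one_iff hd.ne', hpow]
    exact h.map_single_le_one δ _ hδ
  · rw [← pow_lt_one_iff hd.ne', hpow]
    exact h.map_single_lt_one δ _ hδ

theorem IsCentred.exists_leadingCoeff [IsAlgClosed K] (hω : LinearIndependent ℚ ω)
    {ψ : Laurent K N →+* L} (h : IsCentred ω ψ v) {p : Polynomial (Laurent K N)} (hp : p ≠ 0)
    {e : L} (he : p.eval₂ ψ e = 0) {γ : Fin N → ℤ} (hγ : v (ψ (single γ 1) * e) = 1) :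
    ∃ k : K, k ≠ 0 ∧ v (ψ (single γ 1) * e - ψ (single 0 k)) < 1 := by
  have : IsDomain (Laurent K N) := (h.injective hω).isDomain
  obtain ⟨q, hq, hq0⟩ : ∃ q : Polynomial (Laurent K N), q ≠ 0 ∧
      q.eval₂ ψ (ψ (single γ 1) * e) = 0 := by
    algebraize [ψ]
    exact (isAlgebraic_algebraMap _).mul ⟨p, hp, he⟩
  obtain ⟨k, hk⟩ := h.exists_residue hω hq hq0 hγ.le
  refine ⟨k, ?_, hk⟩
  rintro rfl
  rw [AddMonoidAlgebra.single_zero, map_zero, sub_zero] at hk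
  exact hk.ne hγ

theorem IsCentred.exists_hasLeadingTerms [IsAlgClosed K] [IsAlgClosed L]
    (hω : LinearIndependent ℚ ω) {ψ : Laurent K N →+* L} (h : IsCentred ω ψ v) {z : Fin M → L}
    (hz : ∀ i, ∃ p : Polynomial (Laurent K N), p ≠ 0 ∧ p.eval₂ ψ (z i) = 0) :
    ∃ (D : OmegaSet K M ω) (ξ : Laurent K N →+* L), ξ.comp (power K N (denom D.Γ)) = ψ ∧
      HasLeadingTerms D ξ v z := by
  have hexp : ∀ i, ∃ n : ℕ, 0 < n ∧ ∃ γ, z i ≠ 0 → v (z i) ^ n = v (ψ (single γ 1)) := fun i => by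
    by_cases hi : z i = 0
    · exact ⟨1, one_pos, 0, fun h => absurd hi h⟩
    · obtain ⟨p, hp, hp0⟩ := hz i
      obtain ⟨n, hn, γ, hγ⟩ := h.exists_pow_eq hω hp hp0 hi
      exact ⟨n, hn, γ, fun _ => hγ⟩
  choose n hn γ hγ using hexp
  obtain ⟨D, hη, hrow⟩ :=
    exists_omegaSet_nsmul_scaledRow_eq (K := K) ω {i | z i = 0} hn γ
  obtain ⟨ξ, rfl⟩ := exists_comp_power_eq ψ (denom_pos D.Γ)
  have hξ := h.of_comp_power (denom_pos D.Γ)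
  have hval : ∀ i, z i ≠ 0 → v (ξ (single (-scaledRow D.Γ i) 1) * z i) = 1 := fun i hi => by
    refine (pow_eq_one_iff.1 ?_).resolve_right (hn i).ne'
    rw [map_mul, mul_pow, hγ i hi, RingHom.comp_apply, power_single,
      ← map_pow, ← map_pow, AddMonoidAlgebra.single_pow, one_pow, smul_neg, hrow i hi, mul_comm,
      map_single_mul_map_single_neg]
  have hlead : ∀ i, ∃ k : K, (k = 0 ↔ z i = 0) ∧
      v (ξ (single (-scaledRow D.Γ i) 1) * z i - ξ (single 0 k)) < 1 := fun i => by
    by_cases hi : z i = 0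
    · exact ⟨0, by simp [hi]⟩
    · obtain ⟨p, hp, hp0⟩ := hz i
      obtain ⟨k, hk, hlt⟩ := hξ.exists_leadingCoeff hω
        ((Polynomial.map_ne_zero_iff (power_injective (denom_pos D.Γ).ne')).2 hp)
        (by rwa [Polynomial.eval₂_map]) (hval i hi)
      exact ⟨k, by simp [hk, hi], hlt⟩
  choose c hc hlt using hlead
  exact ⟨{ D with
    c := c
    c_ne_zero := fun i hi => fun h0 => hi ((hη i).2 ((hc i).1 h0))
    c_eq_zero := fun i hi => (hc i).2 ((hη i).1 hi) }, ξ, rfl, hξ, fun i => (hη i).1, hlt⟩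

end LeadingTerms

section Step

variable {K : Type*} [Field K] {N M : ℕ} {ω : Fin N → ℝ}

theorem eval₂_eq_zero_of_mem_transform {L : Type*} [CommRing L] {I : Ideal (LaurentPoly K N M)}
    {D : OmegaSet K M ω} {ψ : Laurent K N →+* L} {y : Fin M → L}
    (hI : ∀ f ∈ I, f.eval₂ (ψ.comp (power K N (denom D.Γ))) y = 0) {g : LaurentPoly K N M}
    (hg : g ∈ transform I D) :
    g.eval₂ ψ (fun i => y i - ψ (single (scaledRow D.Γ i) (D.c i))) = 0 := by
  let z : Fin M → L := fun i => y i - ψ (single (scaledRow D.Γ i) (D.c i))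
  have hcomp : (eval₂Hom ψ z).comp (substitution D) =
      eval₂Hom (ψ.comp (power K N (denom D.Γ))) y :=
    MvPolynomial.ringHom_ext (fun a => by simp [substitution, power])
      fun i => by simp [substitution, z]
  suffices hle : transform I D ≤ RingHom.ker (eval₂Hom ψ z) from hle hg
  refine Ideal.span_le.2 ?_
  rintro _ ⟨f, hf, rfl⟩
  exact (RingHom.congr_fun hcomp f).trans (hI f hf)

section Exceeds

variable {L Γ₀ : Type*} [Field L] [LinearOrderedCommGroupWithZero Γ₀] {v : Valuation L Γ₀}
  {D D' : OmegaSet K M ω} {ψ : Laurent K N →+* L} {y : Fin M → L}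

theorem HasLeadingTerms.map_mul_eq_one (h : HasLeadingTerms D ψ v y) {i : Fin M}
    (hi : D.η i ≠ ⊤) : v (ψ (single (-scaledRow D.Γ i) 1) * y i) = 1 := by
  have hc := h.isCentred.map_single_zero (D.c_ne_zero i hi)
  rw [← hc]
  exact Valuation.map_eq_of_sub_lt v (hc.symm ▸ h.map_sub_lt_one i)

theorem HasLeadingTerms.exceeds (hω : LinearIndependent ℚ ω)
    (h : HasLeadingTerms D (ψ.comp (power K N (denom D'.Γ))) v y)
    (h' : HasLeadingTerms D' ψ v fun i =>
      y i - ψ.comp (power K N (denom D'.Γ)) (single (scaledRow D.Γ i) (D.c i))) :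
    Exceeds D D' := by
  intro i hi
  set r := scaledRow D.Γ i
  set r' := scaledRow D'.Γ i
  set z := y i - ψ.comp (power K N (denom D'.Γ)) (single r (D.c i)) with hz
  have hz1 : v (ψ (single (-r') 1) * z) = 1 := h'.map_mul_eq_one hi
  have htop : D.η i ≠ ⊤ := fun htop => by
    rw [hz, h.eq_zero i htop, D.c_eq_zero i htop] at hz1
    simp at hz1
  have hlt : v (ψ (single (-(denom D'.Γ • r)) 1) * z) < 1 := by
    have := h.map_sub_lt_one i
    simpa [hz, mul_sub, power_single, ← map_mul, AddMonoidAlgebra.single_mul_single] using this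
  have hpos : 0 < dot ω (r' - denom D'.Γ • r) := by
    refine h'.isCentred.dot_pos ?_
    have hsplit : single (-(denom D'.Γ • r)) (1 : K) =
        single (r' - denom D'.Γ • r) 1 * single (-r') 1 := by
      rw [AddMonoidAlgebra.single_mul_single, mul_one]
      congr 1
      abel
    rwa [hsplit, map_mul ψ, mul_assoc, map_mul v, hz1, mul_one] at hlt
  lift D.η i to ℝ using htop with e he
  lift D'.η i to ℝ using hi with e' he'
  have hd : (0 : ℝ) < denom D'.Γ := Nat.cast_pos.2 (denom_pos _)
  rw [map_sub, map_nsmul, D.dot_scaledRow hω, D'.dot_scaledRow hω, ← he, ← he',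
    WithTop.untopD_coe, WithTop.untopD_coe, nsmul_eq_mul, ← mul_sub, mul_pos_iff_of_pos_left hd,
    sub_pos] at hpos
  rwa [← WithTop.coe_mul, WithTop.coe_lt_coe]

end Exceeds

variable [IsAlgClosed K]

theorem IsStarting.transform_isNAdmissible_and_exists (hω : LinearIndependent ℚ ω)
    {I : Ideal (LaurentPoly K N M)} (hI : IsNAdmissible I) {D : OmegaSet K M ω}
    (hD : IsStarting I D) : IsNAdmissible (transform I D) ∧
      ∃ D' : OmegaSet K M ω, IsStarting (transform I D) D' ∧ Exceeds D D' := by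
  have halg := hI.isAlgebraicMod.transform D
  obtain ⟨L, _, _, ψ, y, V, hy, hyI⟩ := hD.exists_hasLeadingTerms hω
  let z : Fin M → L := fun i => y i - ψ (single (scaledRow D.Γ i) (D.c i))
  have hz : ∀ g ∈ transform I D, g.eval₂ ψ z = 0 := fun g => eval₂_eq_zero_of_mem_transform hyI
  refine ⟨halg.isNAdmissible fun a ha => ?_, ?_⟩
  · have := hz _ ha
    rwa [eval₂_C, map_eq_zero_iff ψ (hy.isCentred.injective hω)] at this
  · have hzalg : ∀ i, ∃ p : Polynomial (Laurent K N), p ≠ 0 ∧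
        p.eval₂ ψ (z i) = 0 := fun i => by
      obtain ⟨p, hp0, hp⟩ := halg i
      have heval := hz _ hp
      have hC : (eval₂Hom ψ z).comp C = ψ := RingHom.ext fun a => eval₂Hom_C ψ z a
      rw [← coe_eval₂Hom, Polynomial.hom_eval₂, hC, coe_eval₂Hom, eval₂_X] at heval
      exact ⟨p, hp0, heval⟩
    obtain ⟨D', ξ, rfl, hD'⟩ := hy.isCentred.exists_hasLeadingTerms hω hzalg
    exact ⟨D', hD'.isStarting hω hz, hy.exceeds hω hD'⟩

end Step

section Sequences

variable {K : Type*} [Field K] {N M : ℕ} {ω : Fin N → ℝ} {I : Ideal (LaurentPoly K N M)}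
  {S : ℕ → OmegaSet K M ω} {L : ℕ∞}

theorem idealSeq_succ (I : Ideal (LaurentPoly K N M)) (S : ℕ → OmegaSet K M ω) (k : ℕ) :
    idealSeq I S (k + 1) = idealSeq (transform I (S 0)) (fun i => S (i + 1)) k := by
  induction k with
  | zero => rfl
  | succ k ih => rw [idealSeq, ih, idealSeq]

theorem isOmegaSequence_add_one_iff : IsOmegaSequence I (L + 1) S ↔
    IsStarting I (S 0) ∧ Exceeds (S 0) (S 1) ∧
      IsOmegaSequence (transform I (S 0)) L fun i => S (i + 1) := by
  have hle : ∀ i : ℕ, ((i + 1 : ℕ) : ℕ∞) ≤ L + 1 ↔ (i : ℕ∞) ≤ L := fun i => by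
    rw [Nat.cast_add_one, ENat.add_le_add_iff_right ENat.one_ne_top]
  simp only [IsOmegaSequence, ← idealSeq_succ, ← hle]
  refine ⟨fun h => ⟨h.1 0 zero_le, h.2 0 ((hle 0).2 zero_le), fun i => h.1 (i + 1),
    fun i => h.2 (i + 1)⟩, fun ⟨h0, h1, h2, h3⟩ => ⟨?_, ?_⟩⟩
  · rintro (_ | i) hi
    exacts [h0, h2 i hi]
  · rintro (_ | i) hi
    exacts [h1, h3 i hi]

theorem IsOmegaSequence.mono {L' : ℕ∞} (h : IsOmegaSequence I L S) (hL : L' ≤ L) :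
    IsOmegaSequence I L' S :=
  ⟨fun i hi => h.1 i (hi.trans hL), fun i hi => h.2 i (hi.trans hL)⟩

variable [IsAlgClosed K]

theorem IsStarting.exists_isOmegaSequence_top (hω : LinearIndependent ℚ ω) (hI : IsNAdmissible I)
    {D : OmegaSet K M ω} (hD : IsStarting I D) :
    ∃ S : ℕ → OmegaSet K M ω, S 0 = D ∧ IsOmegaSequence I ⊤ S := by
  let State := {p : Ideal (LaurentPoly K N M) × OmegaSet K M ω //
    IsNAdmissible p.1 ∧ IsStarting p.1 p.2}
  have hstep : ∀ p : State, ∃ q : State,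
      q.1.1 = transform p.1.1 p.1.2 ∧ Exceeds p.1.2 q.1.2 := by
    rintro ⟨⟨J, E⟩, hJ, hE⟩
    obtain ⟨hJ', E', hE', hEE'⟩ := hE.transform_isNAdmissible_and_exists hω hJ
    exact ⟨⟨⟨_, E'⟩, hJ', hE'⟩, rfl, hEE'⟩
  choose next hnext hexc using hstep
  let T : ℕ → State := fun m => next^[m] ⟨⟨I, D⟩, hI, hD⟩
  have hT : ∀ m, T (m + 1) = next (T m) := fun m => Function.iterate_succ_apply' _ _ _
  have hideal : ∀ m, idealSeq I (fun i => (T i).1.2) m = (T m).1.1 := fun m => by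
    induction m with
    | zero => rfl
    | succ m ih => rw [idealSeq, ih, hT, hnext]
  refine ⟨fun i => (T i).1.2, rfl, fun i _ => hideal i ▸ (T i).2.2, fun i _ => ?_⟩
  simpa only [hT] using hexc (T i)

theorem IsOmegaSequence.exists_isOmegaSequence_top (hω : LinearIndependent ℚ ω)
    (hI : IsNAdmissible I) {k : ℕ} (hS : IsOmegaSequence I k S) :
    ∃ S' : ℕ → OmegaSet K M ω, (∀ i ≤ k, S' i = S i) ∧ IsOmegaSequence I ⊤ S' := by
  induction k generalizing I S with
  | zero =>
    obtain ⟨S', h0, hS'⟩ := (hS.1 0 le_rfl).exists_isOmegaSequence_top hω hI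
    exact ⟨S', fun i hi => Nat.le_zero.1 hi ▸ h0, hS'⟩
  | succ k ih =>
    rw [Nat.cast_add_one, isOmegaSequence_add_one_iff] at hS
    obtain ⟨h0, hexc, hS⟩ := hS
    obtain ⟨T, hTS, hT⟩ := ih (h0.transform_isNAdmissible_and_exists hω hI).1 hS
    refine ⟨fun | 0 => S 0 | i + 1 => T i, ?_, ?_⟩
    · rintro (_ | i) hi
      exacts [rfl, hTS i (Nat.le_of_succ_le_succ hi)]
    · rw [← top_add (1 : ℕ∞), isOmegaSequence_add_one_iff]
      exact ⟨h0, by simpa only [hTS 0 k.zero_le] using hexc, hT⟩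

end Sequences

end

end NewtonPuiseux

theorem mainTheorem6_general {K : Type*} [Field K] [IsAlgClosed K] {N M : ℕ}
    (ω : Fin N → ℝ) (hω : LinearIndependent ℚ ω)
    (I : Ideal (NewtonPuiseux.LaurentPoly K N M)) (hI : NewtonPuiseux.IsNAdmissible I) :
    (∀ D : NewtonPuiseux.OmegaSet K M ω, NewtonPuiseux.IsStarting I D →
      NewtonPuiseux.IsNAdmissible (NewtonPuiseux.transform I D) ∧
      ∃ D' : NewtonPuiseux.OmegaSet K M ω,
        NewtonPuiseux.IsStarting (NewtonPuiseux.transform I D) D' ∧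
        NewtonPuiseux.Exceeds D D') ∧
    (∀ (k : ℕ) (S : ℕ → NewtonPuiseux.OmegaSet K M ω),
      NewtonPuiseux.IsOmegaSequence I (k : ℕ∞) S →
      ∃ S' : ℕ → NewtonPuiseux.OmegaSet K M ω,
        (∀ i ≤ k, S' i = S i) ∧ NewtonPuiseux.IsOmegaSequence I ⊤ S') :=
  ⟨fun _ hD => hD.transform_isNAdmissible_and_exists hω hI,
    fun _ _ hS => hS.exists_isOmegaSequence_top hω hI⟩

theorem mainTheorem6 {K : Type*} [Field K] [IsAlgClosed K] [CharZero K] {N M : ℕ}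
    (ω : Fin N → ℝ) (hω : LinearIndependent ℚ ω)
    (I : Ideal (NewtonPuiseux.LaurentPoly K N M)) (hI : NewtonPuiseux.IsNAdmissible I) :
    (∀ D : NewtonPuiseux.OmegaSet K M ω, NewtonPuiseux.IsStarting I D →
      NewtonPuiseux.IsNAdmissible (NewtonPuiseux.transform I D) ∧
      ∃ D' : NewtonPuiseux.OmegaSet K M ω,
        NewtonPuiseux.IsStarting (NewtonPuiseux.transform I D) D' ∧
        NewtonPuiseux.Exceeds D D') ∧
    (∀ (k : ℕ) (S : ℕ → NewtonPuiseux.OmegaSet K M ω),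
      NewtonPuiseux.IsOmegaSequence I (k : ℕ∞) S →
      ∀ L : ℕ∞, (k : ℕ∞) < L →
        ∃ S' : ℕ → NewtonPuiseux.OmegaSet K M ω,
          (∀ i ≤ k, S' i = S i) ∧ NewtonPuiseux.IsOmegaSequence I L S') := by
  obtain ⟨step, extend⟩ := mainTheorem6_general ω hω I hI
  exact ⟨step, fun k S hS L _ => (extend k S hS).imp fun _ h => ⟨h.1, h.2.mono le_top⟩⟩
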